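/- Throughout, scalars are $\mathbb R$ or $\mathbb C$, algebras are associative (not necessarily unital) algebras over the scalar field, and modules over them need not be unital. For a Banach space $X$ let $\mathcal F(X)$ be the algebra of approximable operators on $X$, i.e. the operator-norm closure of the bounded finite-rank operators $X\to X$. For isomorphic Banach spaces $X,Y$ let $d(X,Y)=\inf\{\|T\|\,\|T^{-1}\| : T \text{ is an isomorphism from } X \text{ to } Y\}$. Let $\{G_i\}_{i\ge 1}$ be a sequence of finite-dimensional Banach spaces such that (i) for each finite-dimensional Banach space $F$ and each $\varepsilon>0$ there is an $i$ with $G_i$ isomorphic to $F$ and $d(F,G_i)<1+\varepsilon$; and (ii) for each $i$ there are infinitely many $j\ne i$ such that $G_j$ is isometric to $G_i$. Let $C_1=\big(\bigoplus_{i=1}^\infty G_i\big)_1$ be the $\ell_1$-direct sum. A right module $X$ over an algebra $A$ is flat if for every short exact sequence $0\to M'\to M\to M''\to 0$ of left $A$-modules the sequence $0\to X\otimes_A M'\to X\otimes_A M\to X\otimes_A M''\to 0$ is exact. An algebra $A$ is right flat if it is flat as a right module over itself, and right universally flat if, whenever $A$ is embedded as a right ideal in an algebra $B$, $A$ is a flat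 right $B$-module. A Banach space $E$ has the approximation property if for every compact $K\subseteq E$ and every $\varepsilon>0$ there is a bounded finite-rank operator $T$ on $E$ with $\|Tx-x\|\le\varepsilon$ for all $x\in K$. **Theorem.** For each Banach space $E$ the following are equivalent: (1) $E$ has the approximation property; (2) $\mathcal F(E\oplus C_1)$ is right flat; (3) $\mathcal F(E\oplus C_1)$ is right universally flat. -/

import Mathlib

open scoped TensorProduct ENNReal

universe u v w

/-! ### Modules over (not necessarily unital) algebras, and flatness -/

section Flatness

/-- A left module over the associative, not necessarily unital, `k`-algebra `A`, on the
`k`-vector space `M`. -/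
structure LeftAction (k : Type*) (A : Type*) (M : Type*) [Field k] [NonUnitalRing A] [Module k A]
    [AddCommGroup M] [Module k M] where
  /-- `act a m` is `a · m`. -/
  act : A →ₗ[k] M →ₗ[k] M
  act_mul : ∀ (a b : A) (m : M), act (a * b) m = act a (act b m)

/-- A right module over the associative, not necessarily unital, `k`-algebra `A`, on the
`k`-vector space `X`. -/
structure RightAction (k : Type*) (A : Type*) (X : Type*) [Field k] [NonUnitalRing A] [Module k A]
    [AddCommGroup X] [Module k X] where
  /-- `act a x` is `x · a`. -/
  act : A →ₗ[k] X →ₗ[k] X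
  act_mul : ∀ (a b : A) (x : X), act (a * b) x = act b (act a x)

variable {k A X M N : Type*} [Field k] [NonUnitalRing A] [Module k A]
  [AddCommGroup X] [Module k X] [AddCommGroup M] [Module k M] [AddCommGroup N] [Module k N]

/-- `f : M → N` is a homomorphism of left `A`-modules. -/
def LeftAction.IsHom (ρ : LeftAction k A M) (σ : LeftAction k A N) (f : M →ₗ[k] N) : Prop :=
  ∀ (a : A) (m : M), f (ρ.act a m) = σ.act a (f m)

/-- The span of the elements `x · a ⊗ m - x ⊗ a · m` of `X ⊗[k] M`. -/
def balancedSubmodule (r : RightAction k A X) (ρ : LeftAction k A M) : Submodule k (X ⊗[k] M) :=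
  Submodule.span k {t | ∃ (x : X) (a : A) (m : M), t = r.act a x ⊗ₜ[k] m - x ⊗ₜ[k] ρ.act a m}

/-- The tensor product `X ⊗_A M` of a right `A`-module and a left `A`-module. -/
abbrev BalancedTensor (r : RightAction k A X) (ρ : LeftAction k A M) : Type _ :=
  (X ⊗[k] M) ⧸ balancedSubmodule r ρ

theorem balancedSubmodule_le_comap (r : RightAction k A X) (ρ : LeftAction k A M)
    (σ : LeftAction k A N) (f : M →ₗ[k] N) (hf : ρ.IsHom σ f) :
    balancedSubmodule r ρ ≤ (balancedSubmodule r σ).comap (f.lTensor X) := by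
  refine Submodule.span_le.2 ?_
  rintro _ ⟨x, a, m, rfl⟩
  refine Submodule.subset_span ⟨x, a, f m, ?_⟩
  rw [map_sub, LinearMap.lTensor_tmul, LinearMap.lTensor_tmul, hf]

/-- The map `I ⊗ f : X ⊗_A M → X ⊗_A N` induced by a homomorphism `f` of left `A`-modules. -/
def balancedMap (r : RightAction k A X) (ρ : LeftAction k A M) (σ : LeftAction k A N)
    (f : M →ₗ[k] N) (hf : ρ.IsHom σ f) : BalancedTensor r ρ →ₗ[k] BalancedTensor r σ :=
  (balancedSubmodule r ρ).mapQ (balancedSubmodule r σ) (f.lTensor X)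
    (balancedSubmodule_le_comap r ρ σ f hf)

end Flatness

/-- The right `A`-module `X` is flat: `X ⊗_A -` sends short exact sequences of left `A`-modules
to short exact sequences. -/
def RightAction.IsFlat {k : Type u} {A : Type v} {X : Type w} [Field k] [NonUnitalRing A]
    [Module k A] [AddCommGroup X] [Module k X] (r : RightAction k A X) : Prop :=
  ∀ (M' M M'' : Type (max u v w)) [AddCommGroup M'] [Module k M'] [AddCommGroup M] [Module k M]
    [AddCommGroup M''] [Module k M''] (ρ' : LeftAction k A M') (ρ : LeftAction k A M)
    (ρ'' : LeftAction k A M'') (f : M' →ₗ[k] M) (g : M →ₗ[k] M'')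
    (hf : ρ'.IsHom ρ f) (hg : ρ.IsHom ρ'' g),
    Function.Injective f → Function.Exact f g → Function.Surjective g →
      Function.Injective (balancedMap r ρ' ρ f hf) ∧
      Function.Exact (balancedMap r ρ' ρ f hf) (balancedMap r ρ ρ'' g hg) ∧
      Function.Surjective (balancedMap r ρ ρ'' g hg)

section UniversalFlatness

/-- A right ideal `J` of the algebra `B`, as a right `B`-module. -/
def rightIdealAction {k B : Type*} [Field k] [NonUnitalRing B] [Module k B]
    [IsScalarTower k B B] [SMulCommClass k B B] (J : Submodule k B)
    (hJ : ∀ x ∈ J, ∀ b : B, x * b ∈ J) : RightAction k B J where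
  act := LinearMap.mk₂ k (fun b x => ⟨x.1 * b, hJ x.1 x.2 b⟩)
    (fun b b' x => Subtype.ext (mul_add x.1 b b'))
    (fun c b x => Subtype.ext (mul_smul_comm c x.1 b))
    (fun b x y => Subtype.ext (add_mul x.1 y.1 b))
    (fun c b x => Subtype.ext (smul_mul_assoc c x.1 b))
  act_mul a b x := Subtype.ext (mul_assoc x.1 a b).symm

/-- An algebra as a right module over itself. -/
def rightMulAction (k A : Type*) [Field k] [NonUnitalRing A] [Module k A]
    [IsScalarTower k A A] [SMulCommClass k A A] : RightAction k A A where
  act := (LinearMap.mul k A).flip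
  act_mul a b x := (mul_assoc x a b).symm

/-- The algebra `A` is right flat: it is flat as a right module over itself. -/
def IsRightFlat (k A : Type*) [Field k] [NonUnitalRing A] [Module k A]
    [IsScalarTower k A A] [SMulCommClass k A A] : Prop :=
  (rightMulAction k A).IsFlat

/-- The algebra `A` is right universally flat: whenever `A` is embedded (by `i`) as a right ideal
in an associative, not necessarily unital, algebra `B`, that right ideal is a flat right
`B`-module. -/
def IsRightUniversallyFlat (k : Type u) (A : Type v) [Field k] [NonUnitalRing A] [Module k A]
    [IsScalarTower k A A] [SMulCommClass k A A] : Prop :=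
  ∀ (B : Type v) [NonUnitalRing B] [Module k B] [IsScalarTower k B B] [SMulCommClass k B B]
    (i : A →ₙₐ[k] B), Function.Injective i →
    ∀ hJ : ∀ x ∈ LinearMap.range (i : A →ₗ[k] B), ∀ b : B,
      x * b ∈ LinearMap.range (i : A →ₗ[k] B),
    (rightIdealAction (LinearMap.range (i : A →ₗ[k] B)) hJ).IsFlat

end UniversalFlatness

/-! ### Approximable operators and the approximation property -/

section Operators

variable (𝕜 : Type*) [RCLike 𝕜] (E : Type*) [NormedAddCommGroup E] [NormedSpace 𝕜 E]

/-- The algebra of bounded operators of finite rank on `E`. -/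
def finiteRankOperators : NonUnitalSubalgebra 𝕜 (E →L[𝕜] E) where
  carrier := {T | FiniteDimensional 𝕜 (LinearMap.range (T : E →ₗ[𝕜] E))}
  zero_mem' := by
    have h : LinearMap.range ((0 : E →L[𝕜] E) : E →ₗ[𝕜] E) = ⊥ := LinearMap.range_zero
    change FiniteDimensional 𝕜 (LinearMap.range ((0 : E →L[𝕜] E) : E →ₗ[𝕜] E))
    rw [h]
    infer_instance
  add_mem' := by
    intro S T hS hT
    change FiniteDimensional 𝕜 (LinearMap.range (S : E →ₗ[𝕜] E)) at hS
    change FiniteDimensional 𝕜 (LinearMap.range (T : E →ₗ[𝕜] E)) at hT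
    exact Submodule.finiteDimensional_of_le
      (LinearMap.range_add_le (S : E →ₗ[𝕜] E) (T : E →ₗ[𝕜] E))
  mul_mem' := by
    intro S T hS _
    change FiniteDimensional 𝕜 (LinearMap.range (S : E →ₗ[𝕜] E)) at hS
    exact Submodule.finiteDimensional_of_le
      (LinearMap.range_comp_le_range (T : E →ₗ[𝕜] E) (S : E →ₗ[𝕜] E))
  smul_mem' := by
    intro c T hT
    change FiniteDimensional 𝕜 (LinearMap.range (T : E →ₗ[𝕜] E)) at hT
    refine Submodule.finiteDimensional_of_le
      (S₂ := LinearMap.range (T : E →ₗ[𝕜] E)) ?_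
    rintro _ ⟨x, rfl⟩
    exact Submodule.smul_mem _ c ⟨x, rfl⟩

/-- The algebra `F(E)` of approximable operators on `E`: the norm closure of the finite rank
operators. -/
noncomputable def approximableOperators : NonUnitalSubalgebra 𝕜 (E →L[𝕜] E) :=
  (finiteRankOperators 𝕜 E).topologicalClosure

/-- `E` has the approximation property: the identity is approximated by bounded finite rank
operators, uniformly on each compact set. -/
def HasApproximationProperty : Prop :=
  ∀ K : Set E, IsCompact K → ∀ ε : ℝ, 0 < ε →
    ∃ T ∈ finiteRankOperators 𝕜 E, ∀ x ∈ K, ‖T x - x‖ ≤ ε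

end Operators

/-! ### The sequences of finite-dimensional spaces whose `ℓ¹`-sum is `C₁` -/

section Johnson

/-- The distance `d(X, Y)`, the infimum of `‖T‖ ‖T⁻¹‖` over all isomorphisms `T` from `X` to `Y`
(`∞` if there are none). -/
noncomputable def banachMazurDist (𝕜 : Type*) [RCLike 𝕜] (X Y : Type*) [NormedAddCommGroup X]
    [NormedSpace 𝕜 X] [NormedAddCommGroup Y] [NormedSpace 𝕜 Y] : ℝ≥0∞ :=
  ⨅ T : X ≃L[𝕜] Y, ‖(T : X →L[𝕜] Y)‖ₑ * ‖(T.symm : Y →L[𝕜] X)‖ₑ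

/-- The finite-dimensional spaces `G i` come arbitrarily close to every finite-dimensional space
(each of which is isometric to one in the universe of the scalar field), and each of them occurs
infinitely often up to isometry. -/
structure IsJohnsonSequence (𝕜 : Type u) [RCLike 𝕜] (G : ℕ → Type v)
    [∀ i, NormedAddCommGroup (G i)] [∀ i, NormedSpace 𝕜 (G i)] : Prop where
  finiteDimensional : ∀ i, FiniteDimensional 𝕜 (G i)
  dense : ∀ (F : Type u) [NormedAddCommGroup F] [NormedSpace 𝕜 F] [FiniteDimensional 𝕜 F],
    ∀ ε : ℝ, 0 < ε → ∃ i, banachMazurDist 𝕜 F (G i) < 1 + ENNReal.ofReal ε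
  repeats : ∀ i, {j | j ≠ i ∧ Nonempty (G j ≃ₗᵢ[𝕜] G i)}.Infinite

/-- The space `C₁`: the `ℓ¹`-direct sum of the spaces `G i`. -/
abbrev JohnsonSpace (G : ℕ → Type*) [∀ i, NormedAddCommGroup (G i)] : Type _ := lp G 1

end Johnson

/-! Write `X = E × C₁` and `A = F(X)`. If `E` has the approximation property, so has `X`, since `C₁`
has it. Finitely many `wᵢ` in `A` are sums of fast telescoping series of finite rank operators.
Almost isometric copies of the finite-dimensional ranges occur in distinct summands of `C₁`, so `wᵢ
= v uᵢ` with one approximable `v : C₁ → X` (`IsJohnsonSequence.exists_factorization`). Compactness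
of `v` gives finite rank `Tₖ` with `Tₖ v → v` fast. Factoring `v` along the approximants `Tₖ v`
gives `v = v' u'` with `ker v ⊆ ker u'`, because `v z = 0` forces every `Tₖ v z = 0`. Hence all `wᵢ`
have the form `y d eᵢ` in `A`, where `y d z = 0` implies `d z = 0`. By
`balancedMap_injective_of_factorization` this yields flatness over `A`, and over every algebra
having `A` as a right ideal, since the property is internal to `A`.

Conversely, flatness turns a relation `T S = 0` in `A` into `T = ∑ xᵢ cᵢ` with `xᵢ` in `A` and
bounded `cᵢ` satisfying `cᵢ S = 0`. So `T` is a limit of finite rank operators killing `S`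
(`RightAction.IsFlat.exists_finiteRankMaps`). For a null sequence `xₙ = tₙ yₙ` in `E`, let `w : C₁ →
E` send a copy `eₙ` of the `ℓ¹` basis to `yₙ`, and let `S` have dense range in `ker w`. The
resulting finite rank `φ ≈ w` vanishes on `ker w`, and Hahn–Banach in `c₀` replaces it along `tₙ eₙ`
by `T w` with `T` of finite rank on `E` (`exists_dual_norm_mul_sub_le`). Thus `T xₙ ≈ xₙ` uniformly,
which suffices because null sequences control compact sets. -/

/-! ### Tensor products over an algebra and a flatness criterion -/

section FlatnessCriterion

open Function

/-- Over a field, a linear map factors through every linear map with smaller kernel. -/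
theorem LinearMap.exists_comp_eq_of_ker_le {k V W U : Type*} [Field k] [AddCommGroup V]
    [Module k V] [AddCommGroup W] [Module k W] [AddCommGroup U] [Module k U]
    (T : V →ₗ[k] W) (D : V →ₗ[k] U) (h : LinearMap.ker T ≤ LinearMap.ker D) :
    ∃ p : W →ₗ[k] U, p ∘ₗ T = D := by
  obtain ⟨p, hp⟩ := LinearMap.exists_extend
    (((LinearMap.ker T).liftQ D h) ∘ₗ T.quotKerEquivRange.symm.toLinearMap)
  refine ⟨p, LinearMap.ext fun x => ?_⟩
  have h1 := LinearMap.congr_fun hp ⟨T x, LinearMap.mem_range_self T x⟩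
  have h2 : T.quotKerEquivRange.symm ⟨T x, LinearMap.mem_range_self T x⟩ =
      (LinearMap.ker T).mkQ x := by
    rw [LinearEquiv.symm_apply_eq]
    rfl
  simpa [h2] using h1

variable {k B X M M' M'' : Type*} [Field k] [NonUnitalRing B] [Module k B]
  [AddCommGroup X] [Module k X] [AddCommGroup M] [Module k M] [AddCommGroup M'] [Module k M']
  [AddCommGroup M''] [Module k M'']

theorem smul_tmul_sub_mem_balancedSubmodule (r : RightAction k B X) (ρ : LeftAction k B M)
    (x : X) (b : B) (m : M) :
    r.act b x ⊗ₜ[k] m - x ⊗ₜ[k] ρ.act b m ∈ balancedSubmodule r ρ :=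
  Submodule.subset_span ⟨x, b, m, rfl⟩

theorem balancedSubmodule_le_map_of_surjective (r : RightAction k B X) (ρ : LeftAction k B M)
    (σ : LeftAction k B M'') (g : M →ₗ[k] M'') (hg : ρ.IsHom σ g) (hs : Surjective g) :
    balancedSubmodule r σ ≤ (balancedSubmodule r ρ).map (g.lTensor X) := by
  refine Submodule.span_le.2 ?_
  rintro _ ⟨x, b, n, rfl⟩
  obtain ⟨m, rfl⟩ := hs n
  refine ⟨_, smul_tmul_sub_mem_balancedSubmodule r ρ x b m, ?_⟩
  rw [map_sub, LinearMap.lTensor_tmul, LinearMap.lTensor_tmul, hg]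

theorem balancedMap_surjective (r : RightAction k B X) (ρ : LeftAction k B M)
    (σ : LeftAction k B M'') (g : M →ₗ[k] M'') (hg : ρ.IsHom σ g) (hs : Surjective g) :
    Surjective (balancedMap r ρ σ g hg) := by
  intro q
  obtain ⟨t, rfl⟩ := Submodule.mkQ_surjective _ q
  obtain ⟨s, rfl⟩ := LinearMap.lTensor_surjective X hs t
  exact ⟨Submodule.mkQ _ s, rfl⟩

/-- Tensoring with a right module is right exact. -/
theorem balancedMap_exact (r : RightAction k B X) (ρ' : LeftAction k B M')
    (ρ : LeftAction k B M) (ρ'' : LeftAction k B M'') (f : M' →ₗ[k] M) (g : M →ₗ[k] M'')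
    (hf : ρ'.IsHom ρ f) (hg : ρ.IsHom ρ'' g) (he : Exact f g) (hs : Surjective g) :
    Exact (balancedMap r ρ' ρ f hf) (balancedMap r ρ ρ'' g hg) := by
  intro q
  obtain ⟨t, rfl⟩ := Submodule.mkQ_surjective _ q
  constructor
  · intro h
    have h1 : g.lTensor X t ∈ balancedSubmodule r ρ'' := by
      rw [← Submodule.Quotient.mk_eq_zero]; exact h
    obtain ⟨s, hs1, hs2⟩ := balancedSubmodule_le_map_of_surjective r ρ ρ'' g hg hs h1
    have h2 : g.lTensor X (t - s) = 0 := by rw [map_sub, hs2, sub_self]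
    obtain ⟨t', ht'⟩ := (lTensor_exact X he hs (t - s)).1 h2
    refine ⟨Submodule.mkQ _ t', ?_⟩
    change Submodule.mkQ _ (f.lTensor X t') = _
    have h3 : (balancedSubmodule r ρ).mkQ s = 0 := (Submodule.Quotient.mk_eq_zero _).2 hs1
    rw [ht', map_sub, h3, sub_zero]
  · rintro ⟨q', h⟩
    obtain ⟨t', rfl⟩ := Submodule.mkQ_surjective _ q'
    rw [← h]
    change Submodule.mkQ _ (g.lTensor X (f.lTensor X t')) = 0
    rw [(lTensor_exact X he hs _).2 ⟨t', rfl⟩, map_zero]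

/-- Every tensor lies in the image of `L ⊗ M` as soon as the range of `L` contains a suitable
finite set. -/
theorem exists_finite_forall_mem_range_rTensor (t : X ⊗[k] M) :
    ∃ S : Set X, S.Finite ∧ ∀ L : X →ₗ[k] X, (∀ x ∈ S, ∃ e, L e = x) →
      ∃ t₀, L.rTensor M t₀ = t := by
  induction t with
  | zero => exact ⟨∅, Set.finite_empty, fun L _ => ⟨0, map_zero _⟩⟩
  | tmul x m =>
    refine ⟨{x}, Set.finite_singleton x, fun L hL => ?_⟩
    obtain ⟨e, rfl⟩ := hL x rfl
    exact ⟨e ⊗ₜ m, LinearMap.rTensor_tmul _ _ _ _⟩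
  | add s t hs ht =>
    obtain ⟨S, hS, h1⟩ := hs
    obtain ⟨T, hT, h2⟩ := ht
    refine ⟨S ∪ T, hS.union hT, fun L hL => ?_⟩
    obtain ⟨a, rfl⟩ := h1 L fun x hx => hL x (Or.inl hx)
    obtain ⟨b, rfl⟩ := h2 L fun x hx => hL x (Or.inr hx)
    exact ⟨a + b, map_add _ _ _⟩

/-- A relation involves finitely many generators. Since `L` commutes with the action, it carries the
relation at `e` to the relation at `L e`, so relations lift to relations. -/
theorem exists_finite_forall_mem_map_balancedSubmodule (r : RightAction k B X)
    (ρ : LeftAction k B M) (s : X ⊗[k] M) (hs : s ∈ balancedSubmodule r ρ) :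
    ∃ S : Set X, S.Finite ∧ ∀ L : X →ₗ[k] X, (∀ b x, L (r.act b x) = r.act b (L x)) →
      (∀ x ∈ S, ∃ e, L e = x) → ∃ s₀ ∈ balancedSubmodule r ρ, L.rTensor M s₀ = s := by
  induction hs using Submodule.span_induction with
  | zero => exact ⟨∅, Set.finite_empty, fun L _ _ => ⟨0, zero_mem _, map_zero _⟩⟩
  | mem t ht =>
    obtain ⟨x, b, m, rfl⟩ := ht
    refine ⟨{x}, Set.finite_singleton x, fun L hc hL => ?_⟩
    obtain ⟨e, rfl⟩ := hL x rfl
    refine ⟨_, smul_tmul_sub_mem_balancedSubmodule r ρ e b m, ?_⟩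
    rw [map_sub, LinearMap.rTensor_tmul, LinearMap.rTensor_tmul, hc]
  | add s t _ _ hs ht =>
    obtain ⟨S, hS, h1⟩ := hs
    obtain ⟨T, hT, h2⟩ := ht
    refine ⟨S ∪ T, hS.union hT, fun L hc hL => ?_⟩
    obtain ⟨a, ha, rfl⟩ := h1 L hc fun x hx => hL x (Or.inl hx)
    obtain ⟨b, hb, rfl⟩ := h2 L hc fun x hx => hL x (Or.inr hx)
    exact ⟨a + b, add_mem ha hb, map_add _ _ _⟩
  | smul c t _ ht =>
    obtain ⟨S, hS, h1⟩ := ht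
    refine ⟨S, hS, fun L hc hL => ?_⟩
    obtain ⟨a, ha, rfl⟩ := h1 L hc hL
    exact ⟨c • a, Submodule.smul_mem _ _ ha, map_smul _ _ _⟩

/-- For a homomorphism `j : X → B` of right modules, the left multiplication `x ↦ y · j x`. -/
def RightAction.leftMul (r : RightAction k B X) (j : X →ₗ[k] B) (y : X) : X →ₗ[k] X :=
  (r.act.flip y) ∘ₗ j

theorem RightAction.leftMul_apply (r : RightAction k B X) (j : X →ₗ[k] B) (y x : X) :
    r.leftMul j y x = r.act (j x) y := rfl

theorem RightAction.leftMul_act (r : RightAction k B X) (j : X →ₗ[k] B)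
    (hj : ∀ b x, j (r.act b x) = j x * b) (y : X) (b : B) (x : X) :
    r.leftMul j y (r.act b x) = r.act b (r.leftMul j y x) := by
  rw [leftMul_apply, leftMul_apply, hj, r.act_mul]

/-- A factorization property of a right ideal which makes it flat as a right module. -/
theorem balancedMap_injective_of_factorization (r : RightAction k B X) (j : X →ₗ[k] B)
    (hj : ∀ b x, j (r.act b x) = j x * b)
    (H : ∀ S : Set X, S.Finite → ∃ y d : X,
      (∀ x ∈ S, ∃ e, r.leftMul j y (r.leftMul j d e) = x) ∧
      ∀ z, r.leftMul j y (r.leftMul j d z) = 0 → r.leftMul j d z = 0)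
    (ρ' : LeftAction k B M') (ρ : LeftAction k B M) (f : M' →ₗ[k] M) (hf : ρ'.IsHom ρ f)
    (hi : Injective f) : Injective (balancedMap r ρ' ρ f hf) := by
  rw [← LinearMap.ker_eq_bot, LinearMap.ker_eq_bot']
  intro q hq
  obtain ⟨t, rfl⟩ := Submodule.mkQ_surjective _ q
  have hs : f.lTensor X t ∈ balancedSubmodule r ρ := by
    rw [← Submodule.Quotient.mk_eq_zero]; exact hq
  obtain ⟨S, hSf, hS⟩ := exists_finite_forall_mem_range_rTensor t
  obtain ⟨S', hSf', hS'⟩ := exists_finite_forall_mem_map_balancedSubmodule r ρ _ hs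
  obtain ⟨y, d, hyd, hk⟩ := H (S ∪ S') (hSf.union hSf')
  set D := r.leftMul j d with hD
  set Y := r.leftMul j y with hY
  obtain ⟨t₀, ht₀⟩ := hS (Y ∘ₗ D) fun x hx => hyd x (Or.inl hx)
  obtain ⟨s₀, hs₀, hs₁⟩ := hS' (Y ∘ₗ D) (fun b x => by
    rw [LinearMap.comp_apply, LinearMap.comp_apply, hD, hY, r.leftMul_act j hj,
      r.leftMul_act j hj]) fun x hx => hyd x (Or.inr hx)
  -- `p` is only `k`-linear. This is harmless: it is applied to an equality in the tensor product
  -- over `k`, before passing to the balanced quotient.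
  obtain ⟨p, hp⟩ := LinearMap.exists_comp_eq_of_ker_le (Y ∘ₗ D) D fun z hz => hk z hz
  -- the tensor `(D ⊗ M') t₀` becomes balanced-trivial in `X ⊗ M`
  have h1 : f.lTensor X (D.rTensor M' t₀) ∈ balancedSubmodule r ρ := by
    have h2 : f.lTensor X (D.rTensor M' t₀) = D.rTensor M s₀ := by
      have h3 : (Y ∘ₗ D).rTensor M (f.lTensor X t₀) = (Y ∘ₗ D).rTensor M s₀ := by
        rw [hs₁, ← ht₀]
        exact LinearMap.congr_fun ((LinearMap.rTensor_comp_lTensor ..).trans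
          (LinearMap.lTensor_comp_rTensor ..).symm) t₀
      have h4 : D.rTensor M (f.lTensor X t₀) = D.rTensor M s₀ := by
        rw [← hp, LinearMap.rTensor_comp, LinearMap.comp_apply, LinearMap.comp_apply, h3]
      rw [← h4]
      exact LinearMap.congr_fun ((LinearMap.lTensor_comp_rTensor ..).trans
        (LinearMap.rTensor_comp_lTensor ..).symm) t₀
    rw [h2]
    clear h2 hs₁
    induction hs₀ using Submodule.span_induction with
    | zero => rw [map_zero]; exact zero_mem _
    | mem t ht =>
      obtain ⟨x, b, m, rfl⟩ := ht
      rw [map_sub, LinearMap.rTensor_tmul, LinearMap.rTensor_tmul, hD, r.leftMul_act j hj]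
      exact smul_tmul_sub_mem_balancedSubmodule r ρ _ b m
    | add s t _ _ hs ht => rw [map_add]; exact add_mem hs ht
    | smul c t _ ht => rw [map_smul]; exact Submodule.smul_mem _ _ ht
  let μ : X ⊗[k] M →ₗ[k] M := TensorProduct.lift (ρ.act ∘ₗ j)
  let μ' : X ⊗[k] M' →ₗ[k] M' := TensorProduct.lift (ρ'.act ∘ₗ j)
  have hμ : balancedSubmodule r ρ ≤ LinearMap.ker μ := by
    refine Submodule.span_le.2 ?_
    rintro _ ⟨x, b, m, rfl⟩
    change μ _ = 0
    simp [μ, hj, ρ.act_mul]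
  have hμf : ∀ s, μ (f.lTensor X s) = f (μ' s) := by
    intro s
    induction s with
    | zero => simp
    | tmul x m => simp [μ, μ', hf _ _]
    | add a b ha hb => simp only [map_add, ha, hb]
  have h5 : μ' (D.rTensor M' t₀) = 0 := by
    apply hi
    rw [← hμf, map_zero]
    exact hμ h1
  -- Modulo balancing, `y · j x ⊗ m = y ⊗ j x · m`. So `Y` factors through the multiplication map
  -- `μ'`, which kills `(D ⊗ M') t₀`.
  have h6 : ∀ s, Y.rTensor M' s - y ⊗ₜ μ' s ∈ balancedSubmodule r ρ' := by
    intro s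
    induction s with
    | zero => simp
    | tmul x m => exact smul_tmul_sub_mem_balancedSubmodule r ρ' y (j x) m
    | add a b ha hb =>
      rw [map_add, map_add, TensorProduct.tmul_add, add_sub_add_comm]
      exact add_mem ha hb
  have h7 := h6 (D.rTensor M' t₀)
  rw [h5, TensorProduct.tmul_zero, sub_zero, ← LinearMap.comp_apply, ← LinearMap.rTensor_comp,
    ht₀] at h7
  exact (Submodule.Quotient.mk_eq_zero _).2 h7

theorem RightAction.isFlat_of_factorization {k : Type u} {B : Type v} {X : Type w} [Field k]
    [NonUnitalRing B] [Module k B] [AddCommGroup X] [Module k X]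
    (r : RightAction k B X) (j : X →ₗ[k] B) (hj : ∀ b x, j (r.act b x) = j x * b)
    (H : ∀ S : Set X, S.Finite → ∃ y d : X,
      (∀ x ∈ S, ∃ e, r.leftMul j y (r.leftMul j d e) = x) ∧
      ∀ z, r.leftMul j y (r.leftMul j d z) = 0 → r.leftMul j d z = 0) : r.IsFlat :=
  fun _ _ _ _ _ _ _ _ _ ρ' ρ ρ'' f g hf hg hi he hs =>
    ⟨balancedMap_injective_of_factorization r j hj H ρ' ρ f hf hi,
      balancedMap_exact r ρ' ρ ρ'' f g hf hg he hs, balancedMap_surjective r ρ ρ'' g hg hs⟩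

/-- The hypothesis mentions only products inside `A`, so it transfers verbatim to the image of `A`
in any `B`. -/
theorem isRightUniversallyFlat_of_factorization {k : Type u} {A : Type v} [Field k]
    [NonUnitalRing A] [Module k A] [IsScalarTower k A A] [SMulCommClass k A A]
    (H : ∀ S : Set A, S.Finite → ∃ y d : A, (∀ x ∈ S, ∃ e, y * (d * e) = x) ∧
      ∀ z, y * (d * z) = 0 → d * z = 0) : IsRightUniversallyFlat k A := by
  intro B _ _ _ _ i hi hJ
  refine RightAction.isFlat_of_factorization _ (Submodule.subtype _) (fun _ _ => rfl)
    fun S hS => ?_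
  let φ : A → LinearMap.range (i : A →ₗ[k] B) := fun a => ⟨i a, a, rfl⟩
  have hφ : Injective φ := fun a b h => hi (congrArg Subtype.val h)
  have hφs : Surjective φ := fun ⟨_, a, h⟩ => ⟨a, Subtype.ext h⟩
  obtain ⟨y, d, h1, h2⟩ := H (φ ⁻¹' S) (hS.preimage hφ.injOn)
  have hm : ∀ a b, RightAction.leftMul (rightIdealAction _ hJ) (Submodule.subtype _) (φ a) (φ b) =
      φ (a * b) := fun a b => Subtype.ext (map_mul i a b).symm
  have h0 : φ 0 = 0 := Subtype.ext (map_zero i)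
  refine ⟨φ y, φ d, fun x hx => ?_, fun z hz => ?_⟩
  · obtain ⟨a, rfl⟩ := hφs x
    obtain ⟨e, he⟩ := h1 a hx
    exact ⟨φ e, by rw [hm, hm, he]⟩
  · obtain ⟨a, rfl⟩ := hφs z
    rw [hm, hm, ← h0] at hz
    rw [hm, h2 a (hφ hz), h0]

/-- The restriction of a left action to an invariant subspace. -/
def LeftAction.restrict (ρ : LeftAction k B M) (N : Submodule k M)
    (hN : ∀ b, ∀ m ∈ N, ρ.act b m ∈ N) : LeftAction k B N where
  act := LinearMap.mk₂ k (fun b m => ⟨ρ.act b m.1, hN b m.1 m.2⟩)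
    (fun b b' m => Subtype.ext (by simp))
    (fun c b m => Subtype.ext (by simp))
    (fun b m m' => Subtype.ext (by simp))
    (fun c b m => Subtype.ext (by simp))
  act_mul a b m := Subtype.ext (ρ.act_mul a b m)

/-- The action on the quotient by an invariant subspace. -/
def LeftAction.quotient (ρ : LeftAction k B M) (N : Submodule k M)
    (hN : ∀ b, ∀ m ∈ N, ρ.act b m ∈ N) : LeftAction k B (M ⧸ N) where
  act :=
    { toFun := fun b => N.mapQ N (ρ.act b) fun m hm => hN b m hm
      map_add' := fun b b' => by ext m; simp
      map_smul' := fun c b => by ext m; simp }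
  act_mul a b m := by
    obtain ⟨m, rfl⟩ := N.mkQ_surjective m
    change N.mkQ (ρ.act (a * b) m) = N.mkQ (ρ.act a (ρ.act b m))
    rw [ρ.act_mul]

/-- In a flat module, `x ⊗ R m = 0` forces `x ⊗ m` to come from the kernel of `R`. -/
theorem RightAction.IsFlat.exists_of_endomorphism {k : Type u} {B : Type v} {X : Type w} [Field k]
    [NonUnitalRing B] [Module k B] [AddCommGroup X] [Module k X]
    {r : RightAction k B X} (hr : r.IsFlat) {M : Type max u v w} [AddCommGroup M] [Module k M]
    (ρ : LeftAction k B M) (R : M →ₗ[k] M) (hR : ρ.IsHom ρ R) (x : X) (m : M)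
    (h : x ⊗ₜ[k] R m ∈ balancedSubmodule r ρ) :
    ∃ t : X ⊗[k] LinearMap.ker R,
      x ⊗ₜ[k] m - (LinearMap.ker R).subtype.lTensor X t ∈ balancedSubmodule r ρ := by
  have hK : ∀ b, ∀ m ∈ LinearMap.ker R, ρ.act b m ∈ LinearMap.ker R := fun b m hm => by
    rw [LinearMap.mem_ker] at hm ⊢
    rw [hR, hm, map_zero]
  have hI : ∀ b, ∀ m ∈ LinearMap.range R, ρ.act b m ∈ LinearMap.range R := by
    rintro b _ ⟨m, rfl⟩
    exact ⟨ρ.act b m, hR b m⟩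
  let ρK := ρ.restrict _ hK
  let ρI := ρ.restrict _ hI
  -- Split `R` as `M ↠ range R ↪ M`. Flatness keeps the inclusion injective after tensoring, and
  -- exactness at the surjection then yields the kernel.
  have h1 := (hr _ _ _ ρI ρ (ρ.quotient _ hI) (LinearMap.range R).subtype
    (LinearMap.range R).mkQ (fun _ _ => rfl) (fun _ _ => rfl) Subtype.val_injective
    (LinearMap.exact_subtype_mkQ _) (Submodule.mkQ_surjective _)).1
  have hR' : ρ.IsHom ρI R.rangeRestrict := fun b m => Subtype.ext (hR b m)
  have h2 := (hr _ _ _ ρK ρ ρI (LinearMap.ker R).subtype R.rangeRestrict (fun _ _ => rfl)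
    hR' Subtype.val_injective (by
      rw [LinearMap.exact_iff, LinearMap.ker_rangeRestrict, Submodule.range_subtype])
    R.surjective_rangeRestrict).2.1
  have h3 : balancedMap r ρ ρI R.rangeRestrict hR' (Submodule.mkQ _ (x ⊗ₜ m)) = 0 := by
    apply h1
    rw [map_zero]
    exact (Submodule.Quotient.mk_eq_zero _).2 h
  obtain ⟨q, hq⟩ := (h2 _).1 h3
  obtain ⟨t, rfl⟩ := Submodule.mkQ_surjective _ q
  refine ⟨t, ?_⟩
  rw [← Submodule.Quotient.mk_eq_zero, Submodule.Quotient.mk_sub, sub_eq_zero]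
  exact hq.symm

end FlatnessCriterion

/-! ### Finite rank and approximable maps between two spaces -/

section ApproximableMaps

open Filter Topology

variable (𝕜 : Type*) [RCLike 𝕜] (X Y : Type*) {Z W : Type*} [NormedAddCommGroup X]
  [NormedSpace 𝕜 X] [NormedAddCommGroup Y] [NormedSpace 𝕜 Y] [NormedAddCommGroup Z]
  [NormedSpace 𝕜 Z] [NormedAddCommGroup W] [NormedSpace 𝕜 W]

/-- The bounded operators of finite rank between two spaces. -/
def finiteRankMaps : Submodule 𝕜 (X →L[𝕜] Y) where
  carrier := {T | FiniteDimensional 𝕜 (LinearMap.range (T : X →ₗ[𝕜] Y))}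
  zero_mem' := by
    change FiniteDimensional 𝕜 (LinearMap.range ((0 : X →L[𝕜] Y) : X →ₗ[𝕜] Y))
    rw [ContinuousLinearMap.toLinearMap_zero, LinearMap.range_zero]
    infer_instance
  add_mem' := by
    intro S T (hS : FiniteDimensional 𝕜 (LinearMap.range (S : X →ₗ[𝕜] Y)))
      (hT : FiniteDimensional 𝕜 (LinearMap.range (T : X →ₗ[𝕜] Y)))
    exact Submodule.finiteDimensional_of_le
      (LinearMap.range_add_le (S : X →ₗ[𝕜] Y) (T : X →ₗ[𝕜] Y))
  smul_mem' := by
    intro c T (hT : FiniteDimensional 𝕜 (LinearMap.range (T : X →ₗ[𝕜] Y)))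
    refine Submodule.finiteDimensional_of_le (S₂ := LinearMap.range (T : X →ₗ[𝕜] Y)) ?_
    rintro _ ⟨x, rfl⟩
    exact Submodule.smul_mem _ c ⟨x, rfl⟩

/-- The norm limits of finite rank operators. -/
noncomputable def approximableMaps : Submodule 𝕜 (X →L[𝕜] Y) :=
  (finiteRankMaps 𝕜 X Y).topologicalClosure

variable {𝕜 X Y}

theorem mem_finiteRankMaps_iff {T : X →L[𝕜] Y} :
    T ∈ finiteRankMaps 𝕜 X Y ↔ FiniteDimensional 𝕜 (LinearMap.range (T : X →ₗ[𝕜] Y)) := Iff.rfl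

theorem mem_approximableOperators_iff {T : X →L[𝕜] X} :
    T ∈ approximableOperators 𝕜 X ↔ T ∈ approximableMaps 𝕜 X X := Iff.rfl

theorem mem_finiteRankOperators_iff {T : X →L[𝕜] X} :
    T ∈ finiteRankOperators 𝕜 X ↔ T ∈ finiteRankMaps 𝕜 X X := Iff.rfl

theorem finiteRankMaps_le_approximableMaps : finiteRankMaps 𝕜 X Y ≤ approximableMaps 𝕜 X Y :=
  Submodule.le_topologicalClosure _

theorem mem_finiteRankMaps_comp_left (S : Y →L[𝕜] Z) {T : X →L[𝕜] Y}
    (hT : T ∈ finiteRankMaps 𝕜 X Y) : S ∘L T ∈ finiteRankMaps 𝕜 X Z := by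
  rw [mem_finiteRankMaps_iff] at hT ⊢
  rw [ContinuousLinearMap.toLinearMap_comp, LinearMap.range_comp]
  infer_instance

theorem mem_finiteRankMaps_comp_right {S : Y →L[𝕜] Z} (hS : S ∈ finiteRankMaps 𝕜 Y Z)
    (T : X →L[𝕜] Y) : S ∘L T ∈ finiteRankMaps 𝕜 X Z := by
  rw [mem_finiteRankMaps_iff] at hS ⊢
  exact Submodule.finiteDimensional_of_le (LinearMap.range_comp_le_range (T : X →ₗ[𝕜] Y)
    (S : Y →ₗ[𝕜] Z))

theorem mem_finiteRankMaps_of_finiteDimensional_left [FiniteDimensional 𝕜 X] (T : X →L[𝕜] Y) :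
    T ∈ finiteRankMaps 𝕜 X Y := by
  rw [mem_finiteRankMaps_iff]
  infer_instance

theorem mem_finiteRankMaps_of_finiteDimensional_right [FiniteDimensional 𝕜 Y] (T : X →L[𝕜] Y) :
    T ∈ finiteRankMaps 𝕜 X Y := by
  rw [mem_finiteRankMaps_iff]
  infer_instance

theorem mem_approximableMaps_comp_left (S : Y →L[𝕜] Z) {T : X →L[𝕜] Y}
    (hT : T ∈ approximableMaps 𝕜 X Y) : S ∘L T ∈ approximableMaps 𝕜 X Z :=
  map_mem_closure (f := fun T : X →L[𝕜] Y => S ∘L T) (by fun_prop) hT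
    fun _ h => mem_finiteRankMaps_comp_left S h

theorem mem_approximableMaps_comp_right {S : Y →L[𝕜] Z} (hS : S ∈ approximableMaps 𝕜 Y Z)
    (T : X →L[𝕜] Y) : S ∘L T ∈ approximableMaps 𝕜 X Z :=
  map_mem_closure (f := fun S : Y →L[𝕜] Z => S ∘L T) (by fun_prop) hS
    fun _ h => mem_finiteRankMaps_comp_right h T

theorem mem_approximableMaps_of_hasSum {ι : Type*} {f : ι → X →L[𝕜] Y} {T : X →L[𝕜] Y}
    (h : HasSum f T) (hf : ∀ i, f i ∈ approximableMaps 𝕜 X Y) : T ∈ approximableMaps 𝕜 X Y :=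
  (Submodule.isClosed_topologicalClosure _).mem_of_tendsto h
    (Eventually.of_forall fun _ => Submodule.sum_mem _ fun i _ => hf i)

theorem exists_finiteRankMaps_norm_sub_le {T : X →L[𝕜] Y} (hT : T ∈ approximableMaps 𝕜 X Y)
    {ε : ℝ} (hε : 0 < ε) : ∃ S ∈ finiteRankMaps 𝕜 X Y, ‖S - T‖ ≤ ε := by
  obtain ⟨S, hS, h⟩ := Metric.mem_closure_iff.1 hT ε hε
  exact ⟨S, hS, by rw [← dist_eq_norm, dist_comm]; exact h.le⟩

theorem isCompactOperator_of_mem_approximableMaps [CompleteSpace Y] {T : X →L[𝕜] Y}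
    (hT : T ∈ approximableMaps 𝕜 X Y) : IsCompactOperator T := by
  refine closure_minimal (s := (finiteRankMaps 𝕜 X Y : Set (X →L[𝕜] Y))) ?_
    (isClosed_setOfPred_isCompactOperator (σ₁₂ := RingHom.id 𝕜)) hT
  intro S (hS : FiniteDimensional 𝕜 (LinearMap.range (S : X →ₗ[𝕜] Y)))
  have : ProperSpace (LinearMap.range (S : X →ₗ[𝕜] Y)) := FiniteDimensional.proper 𝕜 _
  exact (isCompactOperator_of_locallyCompactSpace_dom
    (S.codRestrict (LinearMap.range (S : X →ₗ[𝕜] Y))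
      fun x => ⟨x, rfl⟩)).clm_comp (LinearMap.range (S : X →ₗ[𝕜] Y)).subtypeL

end ApproximableMaps

/-! ### Factoring approximable operators through `C₁` -/

section Johnson

open Filter Topology

theorem norm_evalCLM_le (𝕜 : Type*) [RCLike 𝕜] (G : ℕ → Type*) [∀ i, NormedAddCommGroup (G i)]
    [∀ i, NormedSpace 𝕜 (G i)] (i : ℕ) : ‖lp.evalCLM 𝕜 G 1 i‖ ≤ 1 :=
  LinearMap.mkContinuous_norm_le _ zero_le_one _

variable {𝕜 : Type u} [RCLike 𝕜] {G : ℕ → Type v} [∀ i, NormedAddCommGroup (G i)]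
    [∀ i, NormedSpace 𝕜 (G i)]

/-- Density is assumed only for spaces in the universe of `𝕜`, so the norm of `F` is pulled back to
`F₀`. The bound 2 is density with `ε = 1`. -/
theorem IsJohnsonSequence.exists_equiv (hG : IsJohnsonSequence 𝕜 G) {F₀ : Type u} {F : Type*}
    [AddCommGroup F₀] [Module 𝕜 F₀] [NormedAddCommGroup F] [NormedSpace 𝕜 F]
    [FiniteDimensional 𝕜 F] (e : F₀ ≃ₗ[𝕜] F) :
    ∃ i, ∃ T : F ≃L[𝕜] G i, ‖(T : F →L[𝕜] G i)‖ * ‖(T.symm : G i →L[𝕜] F)‖ ≤ 2 := by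
  let : NormedAddCommGroup F₀ := NormedAddCommGroup.induced F₀ F e.toLinearMap e.injective
  let : NormedSpace 𝕜 F₀ := NormedSpace.induced 𝕜 F₀ F e.toLinearMap
  have : FiniteDimensional 𝕜 F₀ := e.symm.finiteDimensional
  let e' : F₀ ≃ₗᵢ[𝕜] F := ⟨e, fun _ => rfl⟩
  obtain ⟨i, hi⟩ := hG.dense F₀ 1 one_pos
  obtain ⟨T, hT⟩ := iInf_lt_iff.1 hi
  refine ⟨i, e'.symm.toContinuousLinearEquiv.trans T, ?_⟩
  have h1 : ‖(T : F₀ →L[𝕜] G i)‖ * ‖(T.symm : G i →L[𝕜] F₀)‖ ≤ 2 := by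
    have h2 := ENNReal.toReal_mono (by simp) hT.le
    rw [ENNReal.toReal_mul, toReal_enorm, toReal_enorm, ENNReal.ofReal_one,
      show (1 : ℝ≥0∞) + 1 = 2 by norm_num, ENNReal.toReal_ofNat] at h2
    exact h2
  refine le_trans (mul_le_mul ?_ ?_ (norm_nonneg _) (norm_nonneg _)) h1
  · refine ContinuousLinearMap.opNorm_le_bound _ (norm_nonneg _) fun x => ?_
    refine ((T : F₀ →L[𝕜] G i).le_opNorm (e'.symm x)).trans_eq ?_
    rw [LinearIsometryEquiv.norm_map]
  · refine ContinuousLinearMap.opNorm_le_bound _ (norm_nonneg _) fun x => ?_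
    change ‖e' (T.symm x)‖ ≤ _
    rw [LinearIsometryEquiv.norm_map]
    exact (T.symm : G i →L[𝕜] F₀).le_opNorm x

/-- One good `G i` has infinitely many isometric copies. Rescaling by `‖T⁻¹‖` moves all the
distortion into `p`. -/
theorem IsJohnsonSequence.infinite_setOf_retract (hG : IsJohnsonSequence 𝕜 G) (F : Type*)
    [NormedAddCommGroup F] [NormedSpace 𝕜 F] [FiniteDimensional 𝕜 F] :
    {i | ∃ (p : F →L[𝕜] G i) (q : G i →L[𝕜] F), (∀ x, q (p x) = x) ∧ ‖p‖ ≤ 2 ∧ ‖q‖ ≤ 1}.Infinite := by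
  obtain ⟨i, T, hT⟩ := hG.exists_equiv
    (LinearEquiv.ofFinrankEq (Fin (Module.finrank 𝕜 F) → 𝕜) F (by simp))
  refine (hG.repeats i).mono ?_
  rintro j ⟨-, ⟨s⟩⟩
  -- The degenerate case `‖T⁻¹‖ = 0` means `F = 0`.
  rcases (norm_nonneg (T.symm : G i →L[𝕜] F)).eq_or_lt' with h | h
  · refine ⟨0, 0, fun x => ?_, by simp, by simp⟩
    have h1 := (T.symm : G i →L[𝕜] F).le_opNorm (T x)
    rw [h, zero_mul] at h1
    simpa [eq_comm] using h1
  · set c := ‖(T.symm : G i →L[𝕜] F)‖ with hc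
    have hc' : (c : 𝕜) ≠ 0 := RCLike.ofReal_ne_zero.2 h.ne'
    refine ⟨(c : 𝕜) • ((s.symm : G i →L[𝕜] G j) ∘L (T : F →L[𝕜] G i)),
      (c : 𝕜)⁻¹ • ((T.symm : G i →L[𝕜] F) ∘L (s : G j →L[𝕜] G i)), fun x => by simp [hc'], ?_, ?_⟩
    · rw [norm_smul, RCLike.norm_ofReal, abs_of_pos h, mul_comm]
      refine le_trans (mul_le_mul_of_nonneg_right ?_ h.le) hT
      refine ContinuousLinearMap.opNorm_le_bound _ (norm_nonneg _) fun x => ?_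
      change ‖s.symm (T x)‖ ≤ _
      rw [LinearIsometryEquiv.norm_map]
      exact (T : F →L[𝕜] G i).le_opNorm x
    · rw [norm_smul, norm_inv, RCLike.norm_ofReal, abs_of_pos h, inv_mul_le_one₀ h]
      refine ContinuousLinearMap.opNorm_le_bound _ (norm_nonneg _) fun x => ?_
      refine ((T.symm : G i →L[𝕜] F).le_opNorm (s x)).trans_eq ?_
      rw [LinearIsometryEquiv.norm_map]

theorem IsJohnsonSequence.exists_retracts (hG : IsJohnsonSequence 𝕜 G) (F : ℕ → Type*)
    [∀ k, NormedAddCommGroup (F k)] [∀ k, NormedSpace 𝕜 (F k)] [∀ k, FiniteDimensional 𝕜 (F k)] :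
    ∃ τ : ℕ → ℕ, StrictMono τ ∧ ∃ (p : ∀ k, F k →L[𝕜] G (τ k)) (q : ∀ k, G (τ k) →L[𝕜] F k),
      ∀ k, (∀ x, q k (p k x) = x) ∧ ‖p k‖ ≤ 2 ∧ ‖q k‖ ≤ 1 := by
  obtain ⟨τ, hτ, h⟩ := extraction_forall_of_frequently fun k =>
    Nat.frequently_atTop_iff_infinite.2 (hG.infinite_setOf_retract (F k))
  choose p q hpq using h
  exact ⟨τ, hτ, p, q, hpq⟩

/-- Finitely many operators which are fast limits of finite rank operators factor through the
`ℓ¹`-sum, with a common left factor. -/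
theorem IsJohnsonSequence.exists_factorization (hG : IsJohnsonSequence 𝕜 G) {ι Z Y : Type*}
    [Finite ι] [NormedAddCommGroup Z] [NormedSpace 𝕜 Z] [NormedAddCommGroup Y] [NormedSpace 𝕜 Y]
    [CompleteSpace Y] (w : ι → Z →L[𝕜] Y) (Q : ι → ℕ → Z →L[𝕜] Y)
    (hQ : ∀ i k, Q i k ∈ finiteRankMaps 𝕜 Z Y) (hw : ∀ i k, ‖Q i k - w i‖ ≤ (1 / 4) ^ k) :
    ∃ v ∈ approximableMaps 𝕜 (JohnsonSpace G) Y, ∀ i,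
      ∃ u ∈ approximableMaps 𝕜 Z (JohnsonSpace G), v ∘L u = w i ∧
        ∀ z, (∀ k, Q i k z = 0) → u z = 0 := by
  have := hG.finiteDimensional
  have : ∀ i, CompleteSpace (G i) := fun i => FiniteDimensional.complete 𝕜 (G i)
  -- Shifting by an initial zero makes the increments `R i k` sum to `w i` with no leftover term.
  let P : ι → ℕ → Z →L[𝕜] Y := fun i k => match k with
    | 0 => 0
    | k + 1 => Q i k
  let R : ι → ℕ → Z →L[𝕜] Y := fun i k => P i (k + 1) - P i k
  have hR0 : ∀ i z, (∀ k, Q i k z = 0) → ∀ k, R i k z = 0 := by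
    intro i z h k
    cases k with
    | zero => simp [R, P, h]
    | succ k => simp [R, P, h]
  -- The 5 comes from `4⁻ᵏ⁻¹ + 4⁻ᵏ = 5 · 4⁻ᵏ⁻¹`; the term `‖Q i 0‖` covers `k = 0`.
  have hRn : ∀ i k, ‖R i k‖ ≤ (5 + ‖Q i 0‖) * (1 / 4) ^ k := by
    intro i k
    cases k with
    | zero => simp [R, P]
    | succ k =>
      have h1 : R i (k + 1) = (Q i (k + 1) - w i) - (Q i k - w i) := by
        simp [R, P]
      have h2 := norm_sub_le (Q i (k + 1) - w i) (Q i k - w i)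
      have h3 : (0 : ℝ) ≤ ‖Q i 0‖ * (1 / 4) ^ (k + 1) := by positivity
      rw [h1]
      have h4 := hw i (k + 1)
      have h5 := hw i k
      rw [pow_succ] at h3 h4 ⊢
      linarith
  have hRs : ∀ i, HasSum (R i) (w i) := by
    intro i
    have hs : Summable (R i) := Summable.of_norm_bounded
      ((summable_geometric_of_lt_one (by norm_num) (by norm_num)).mul_left _) (hRn i)
    refine (hs.hasSum_iff_tendsto_nat).2 ?_
    have h1 : ∀ n, ∑ k ∈ Finset.range n, R i k = P i n := fun n => by
      rw [Finset.sum_range_sub]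
      simp [P]
    simp_rw [h1]
    rw [← tendsto_add_atTop_iff_nat 1, tendsto_iff_norm_sub_tendsto_zero]
    exact squeeze_zero (fun _ => norm_nonneg _) (hw i)
      (tendsto_pow_atTop_nhds_zero_of_lt_one (by norm_num) (by norm_num))
  have hRf : ∀ i k, R i k ∈ finiteRankMaps 𝕜 Z Y := by
    intro i k
    cases k with
    | zero => exact Submodule.sub_mem _ (hQ i 0) (Submodule.zero_mem _)
    | succ k => exact Submodule.sub_mem _ (hQ i _) (hQ i _)
  -- Taking the ranges for all `i` together makes the left factor independent of `i`; finiteness of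
  -- `ι` keeps `F k` finite-dimensional.
  let F : ℕ → Submodule 𝕜 Y := fun k => ⨆ i, LinearMap.range (R i k : Z →ₗ[𝕜] Y)
  have : ∀ k, FiniteDimensional 𝕜 (F k) := fun k => by
    have := fun i => mem_finiteRankMaps_iff.1 (hRf i k)
    exact Submodule.finiteDimensional_iSup _
  have hRF : ∀ i k z, R i k z ∈ F k := fun i k z =>
    Submodule.mem_iSup_of_mem (p := fun i => LinearMap.range (R i k : Z →ₗ[𝕜] Y)) i ⟨z, rfl⟩
  obtain ⟨τ, hτ, p, q, hpq⟩ := hG.exists_retracts fun k => F k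
  -- The decay `4⁻ᵏ` is shared: weights `2⁻ᵏ` here and `2ᵏ` in `U` cancel in the product and leave
  -- both series of order `2⁻ᵏ`.
  let V : ℕ → JohnsonSpace G →L[𝕜] Y := fun k =>
    ((1 / 2 : 𝕜) ^ k) • ((F k).subtypeL ∘L q k ∘L lp.evalCLM 𝕜 G 1 (τ k))
  have hVn : ∀ k, ‖V k‖ ≤ (1 / 2) ^ k := by
    intro k
    rw [norm_smul, norm_pow, norm_div, norm_one, RCLike.norm_ofNat]
    refine mul_le_of_le_one_right (by positivity) ?_
    refine ContinuousLinearMap.opNorm_le_bound _ zero_le_one fun c => ?_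
    change ‖q k (lp.evalCLM 𝕜 G 1 (τ k) c)‖ ≤ 1 * ‖c‖
    exact ((q k).le_of_opNorm_le (hpq k).2.2 _).trans
      (by rw [one_mul]; exact (lp.evalCLM 𝕜 G 1 (τ k)).le_of_opNorm_le (norm_evalCLM_le 𝕜 G _) c)
  have hVs : HasSum V (∑' k, V k) := (Summable.of_norm_bounded
    (summable_geometric_of_lt_one (by norm_num) (by norm_num)) hVn).hasSum
  have hVv : ∀ k g, (∑' k, V k) (lp.single 1 (τ k) g) = ((1 / 2 : 𝕜) ^ k) • (q k g : Y) := by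
    intro k g
    have h1 : HasSum (fun l => V l (lp.single 1 (τ k) g)) ((∑' k, V k) (lp.single 1 (τ k) g)) :=
      hVs.mapL (ContinuousLinearMap.apply 𝕜 Y (lp.single 1 (τ k) g))
    refine h1.unique ?_
    have h2 : V k (lp.single 1 (τ k) g) = ((1 / 2 : 𝕜) ^ k) • (q k g : Y) := by
      change ((1 / 2 : 𝕜) ^ k) • (q k (lp.single 1 (τ k) g (τ k)) : Y) = _
      rw [lp.single_apply_self]
    rw [← h2]
    refine hasSum_single k fun l hl => ?_
    change ((1 / 2 : 𝕜) ^ l) • (q l (lp.single 1 (τ k) g (τ l)) : Y) = 0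
    rw [lp.single_apply_ne _ _ _ (hτ.injective.ne hl)]
    simp
  refine ⟨∑' k, V k, mem_approximableMaps_of_hasSum hVs fun k =>
    finiteRankMaps_le_approximableMaps (Submodule.smul_mem _ _
      (mem_finiteRankMaps_comp_right (mem_finiteRankMaps_of_finiteDimensional_left _) _)),
    fun i => ?_⟩
  let U : ℕ → Z →L[𝕜] JohnsonSpace G := fun k =>
    ((2 : 𝕜) ^ k) • (lp.singleContinuousLinearMap 𝕜 G 1 (τ k) ∘L p k ∘L
      (R i k).codRestrict (F k) (hRF i k))
  have hUn : ∀ k, ‖U k‖ ≤ (2 * (5 + ‖Q i 0‖)) * (1 / 2) ^ k := by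
    intro k
    rw [norm_smul, norm_pow, RCLike.norm_ofNat]
    have h1 : ‖lp.singleContinuousLinearMap 𝕜 G 1 (τ k) ∘L p k ∘L
      (R i k).codRestrict (F k) (hRF i k)‖ ≤ 2 * ((5 + ‖Q i 0‖) * (1 / 4) ^ k) := by
      refine ContinuousLinearMap.opNorm_le_bound _ (by positivity) fun z => ?_
      change ‖lp.single 1 (τ k) (p k _)‖ ≤ _
      rw [lp.norm_single one_pos, mul_assoc]
      refine ((p k).le_of_opNorm_le (hpq k).2.1 _).trans ?_
      refine mul_le_mul_of_nonneg_left ?_ zero_le_two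
      exact (R i k).le_of_opNorm_le (hRn i k) z
    refine (mul_le_mul_of_nonneg_left h1 (by positivity)).trans_eq ?_
    have h2 : (1 / 2 : ℝ) ^ k = 2 ^ k * (1 / 4) ^ k := by
      rw [← mul_pow]; norm_num
    rw [h2]
    ring
  have hUs : HasSum U (∑' k, U k) := (Summable.of_norm_bounded
    ((summable_geometric_of_lt_one (by norm_num) (by norm_num)).mul_left _) hUn).hasSum
  have hUz : ∀ z, HasSum (fun k => U k z) ((∑' k, U k) z) := fun z =>
    hUs.mapL (ContinuousLinearMap.apply 𝕜 (JohnsonSpace G) z)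
  refine ⟨∑' k, U k, mem_approximableMaps_of_hasSum hUs fun k =>
    finiteRankMaps_le_approximableMaps (Submodule.smul_mem _ _
      (mem_finiteRankMaps_comp_left _ (mem_finiteRankMaps_of_finiteDimensional_right _))),
    ?_, fun z hz => ?_⟩
  · ext z
    have h1 : HasSum (fun k => R i k z) (w i z) :=
      (hRs i).mapL (ContinuousLinearMap.apply 𝕜 Y z)
    refine HasSum.unique ((hUz z).mapL (∑' k, V k)) ?_
    convert h1 using 2 with k
    change (∑' k, V k) (((2 : 𝕜) ^ k) • lp.single 1 (τ k) (p k ⟨R i k z, hRF i k z⟩)) = _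
    rw [map_smul, hVv, (hpq k).1, smul_smul, ← mul_pow]
    norm_num
  · refine (hUz z).unique ?_
    convert hasSum_zero with k
    change ((2 : 𝕜) ^ k) • lp.single 1 (τ k) (p k ⟨R i k z, hRF i k z⟩) = 0
    have h1 : (⟨R i k z, hRF i k z⟩ : F k) = 0 := Subtype.ext (hR0 i z hz k)
    rw [h1, map_zero, lp.single_zero, smul_zero]

end Johnson

/-! ### The approximation property of `C₁` and of products -/

section ApproximationProperty

open Filter Topology

variable {𝕜 : Type u} [RCLike 𝕜]

/-- An `ℓ¹`-sum of finite-dimensional spaces has the approximation property. -/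
theorem hasApproximationProperty_lp_one (G : ℕ → Type v) [∀ i, NormedAddCommGroup (G i)]
    [∀ i, NormedSpace 𝕜 (G i)] [∀ i, FiniteDimensional 𝕜 (G i)] :
    HasApproximationProperty 𝕜 (JohnsonSpace G) := by
  intro K hK ε hε
  let P : ℕ → JohnsonSpace G →L[𝕜] JohnsonSpace G := fun n =>
    ∑ i ∈ Finset.range n, lp.singleContinuousLinearMap 𝕜 G 1 i ∘L lp.evalCLM 𝕜 G 1 i
  have hP : ∀ n c, P n c = ∑ i ∈ Finset.range n, lp.single 1 i (c i) := fun n c => by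
    simp only [P, _root_.sum_apply]
    rfl
  have hPn : ∀ n c, ‖P n c‖ ≤ ‖c‖ := by
    intro n c
    have h1 := lp.norm_sum_single (E := G) (p := 1) (by simp) c (Finset.range n)
    have h2 := lp.sum_rpow_le_norm_rpow (E := G) (p := 1) (by simp) c (Finset.range n)
    simp only [ENNReal.toReal_one, Real.rpow_one] at h1 h2
    rw [hP, h1]
    exact h2
  have hPt : ∀ c, Tendsto (fun n => P n c) atTop (𝓝 c) := by
    intro c
    simp_rw [hP]
    exact (lp.hasSum_single ENNReal.one_ne_top c).tendsto_sum_nat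
  have hPf : ∀ n, P n ∈ finiteRankOperators 𝕜 (JohnsonSpace G) := fun n =>
    (mem_finiteRankOperators_iff (𝕜 := 𝕜)).2 (Submodule.sum_mem _ fun i _ =>
      mem_finiteRankMaps_comp_right (mem_finiteRankMaps_of_finiteDimensional_left _) _)
  -- The contractions `P n` converge pointwise to the identity, hence uniformly on `K` through a
  -- finite `ε / 3`-net.
  obtain ⟨t, -, htf, ht⟩ := hK.finite_cover_balls (e := ε / 3) (by positivity)
  have h1 : ∀ᶠ n in atTop, ∀ y ∈ t, dist (P n y) y < ε / 3 :=
    (htf.eventually_all).2 fun y _ => Metric.tendsto_nhds.1 (hPt y) _ (by positivity)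
  obtain ⟨n, hn⟩ := h1.exists
  refine ⟨P n, hPf n, fun x hx => ?_⟩
  obtain ⟨y, hy, hxy⟩ := Set.mem_iUnion₂.1 (ht hx)
  have h2 : P n x - x = P n (x - y) + (P n y - y) - (x - y) := by rw [map_sub]; abel
  rw [Metric.mem_ball, dist_eq_norm] at hxy
  have h3 := hn y hy
  rw [dist_eq_norm] at h3
  rw [h2]
  have h4 := norm_sub_le (P n (x - y) + (P n y - y)) (x - y)
  have h5 := norm_add_le (P n (x - y)) (P n y - y)
  have h6 := hPn n (x - y)
  linarith

variable {E F : Type*} [NormedAddCommGroup E] [NormedSpace 𝕜 E] [NormedAddCommGroup F]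
  [NormedSpace 𝕜 F]

theorem HasApproximationProperty.prod (hE : HasApproximationProperty 𝕜 E)
    (hF : HasApproximationProperty 𝕜 F) : HasApproximationProperty 𝕜 (E × F) := by
  intro K hK ε hε
  obtain ⟨S, hS, hS'⟩ := hE _ (hK.image continuous_fst) ε hε
  obtain ⟨T, hT, hT'⟩ := hF _ (hK.image continuous_snd) ε hε
  refine ⟨S.prodMap T, ?_, fun x hx => ?_⟩
  · have h : S.prodMap T = ContinuousLinearMap.inl 𝕜 E F ∘L S ∘L ContinuousLinearMap.fst 𝕜 E F +
        ContinuousLinearMap.inr 𝕜 E F ∘L T ∘L ContinuousLinearMap.snd 𝕜 E F := by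
      ext x <;> simp
    rw [h, mem_finiteRankOperators_iff]
    exact Submodule.add_mem _
      (mem_finiteRankMaps_comp_left _ (mem_finiteRankMaps_comp_right hS _))
      (mem_finiteRankMaps_comp_left _ (mem_finiteRankMaps_comp_right hT _))
  · exact max_le (hS' _ ⟨x, hx, rfl⟩) (hT' _ ⟨x, hx, rfl⟩)

/-- An approximable `w` is compact, so the property applies to the closure of the image of the unit
ball. -/
theorem HasApproximationProperty.exists_norm_comp_sub_le [CompleteSpace E]
    (hE : HasApproximationProperty 𝕜 E) {w : F →L[𝕜] E} (hw : w ∈ approximableMaps 𝕜 F E)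
    {ε : ℝ} (hε : 0 < ε) : ∃ T ∈ finiteRankMaps 𝕜 E E, ‖T ∘L w - w‖ ≤ ε := by
  obtain ⟨T, hT, h⟩ := hE _
    ((isCompactOperator_of_mem_approximableMaps hw).isCompact_closure_image_closedBall 1) ε hε
  refine ⟨T, hT, ContinuousLinearMap.opNorm_le_of_unit_norm (𝕜 := 𝕜) hε.le fun x hx => ?_⟩
  exact h _ (subset_closure ⟨x, by simp [hx], rfl⟩)

end ApproximationProperty

/-! ### From the approximation property to flatness -/

section Forward

variable {𝕜 : Type u} [RCLike 𝕜] {G : ℕ → Type v} [∀ i, NormedAddCommGroup (G i)]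
    [∀ i, NormedSpace 𝕜 (G i)] {E : Type w} [NormedAddCommGroup E] [NormedSpace 𝕜 E]
    [CompleteSpace E]

/-- The triple factorization property of the approximable operators. -/
theorem HasApproximationProperty.exists_triple_factorization (hG : IsJohnsonSequence 𝕜 G)
    (hE : HasApproximationProperty 𝕜 E)
    (S : Set (approximableOperators 𝕜 (E × JohnsonSpace G))) (hS : S.Finite) :
    ∃ y d : approximableOperators 𝕜 (E × JohnsonSpace G), (∀ x ∈ S, ∃ e, y * (d * e) = x) ∧
      ∀ z, y * (d * z) = 0 → d * z = 0 := by
  have := hG.finiteDimensional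
  have : ∀ i, CompleteSpace (G i) := fun i => FiniteDimensional.complete 𝕜 (G i)
  have hX : HasApproximationProperty 𝕜 (E × JohnsonSpace G) :=
    hE.prod (hasApproximationProperty_lp_one G)
  have := hS.to_subtype
  have hpos : ∀ k : ℕ, (0 : ℝ) < (1 / 4) ^ k := fun k => by positivity
  choose Q hQf hQ using fun (x : S) (k : ℕ) =>
    exists_finiteRankMaps_norm_sub_le (mem_approximableOperators_iff.1 x.1.2) (hpos k)
  obtain ⟨v, hv, hu⟩ := hG.exists_factorization (fun x : S => x.1.1) Q hQf hQ
  choose T hTf hT using fun k : ℕ => hX.exists_norm_comp_sub_le hv (hpos k)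
  -- Approximants of the form `T k ∘ v` vanish wherever `v` does; this is what gives `ker v ⊆ ker
  -- u'`.
  obtain ⟨v', hv', hu'⟩ := hG.exists_factorization (fun _ : Unit => v) (fun _ k => T k ∘L v)
    (fun _ k => mem_finiteRankMaps_comp_right (hTf k) v) (fun _ k => hT k)
  obtain ⟨u', hu'a, hvu', hker⟩ := hu' ()
  let π := ContinuousLinearMap.snd 𝕜 E (JohnsonSpace G)
  let κ := ContinuousLinearMap.inr 𝕜 E (JohnsonSpace G)
  have hvu : ∀ c, v' (u' c) = v c := fun c => DFunLike.congr_fun hvu' c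
  -- The factors through `C₁` become operators on `E × C₁` by means of `π ∘ κ = id`.
  refine ⟨⟨v' ∘L π, mem_approximableOperators_iff.2 (mem_approximableMaps_comp_right hv' π)⟩,
    ⟨κ ∘L u' ∘L π, mem_approximableOperators_iff.2
      (mem_approximableMaps_comp_left κ (mem_approximableMaps_comp_right hu'a π))⟩,
    fun x hx => ?_, fun z hz => ?_⟩
  · obtain ⟨u, hua, hvx, -⟩ := hu ⟨x, hx⟩
    refine ⟨⟨κ ∘L u, mem_approximableOperators_iff.2 (mem_approximableMaps_comp_left κ hua)⟩,
      Subtype.ext ?_⟩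
    rw [← hvx]
    exact ContinuousLinearMap.ext fun c => hvu (u c)
  · refine Subtype.ext (ContinuousLinearMap.ext fun c => ?_)
    have h1 : v' (u' (π (z.1 c))) = 0 := DFunLike.congr_fun (congrArg Subtype.val hz) c
    rw [hvu] at h1
    have h2 : u' (π (z.1 c)) = 0 := hker _ fun k => by
      change T k (v (π (z.1 c))) = 0
      rw [h1, map_zero]
    change κ (u' (π (z.1 c))) = 0
    rw [h2, map_zero]

theorem HasApproximationProperty.isRightFlat (hG : IsJohnsonSequence 𝕜 G)
    (hE : HasApproximationProperty 𝕜 E) :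
    IsRightFlat 𝕜 (approximableOperators 𝕜 (E × JohnsonSpace G)) :=
  (rightMulAction 𝕜 _).isFlat_of_factorization LinearMap.id (fun _ _ => rfl)
    fun S hS => hE.exists_triple_factorization hG S hS

theorem HasApproximationProperty.isRightUniversallyFlat (hG : IsJohnsonSequence 𝕜 G)
    (hE : HasApproximationProperty 𝕜 E) :
    IsRightUniversallyFlat 𝕜 (approximableOperators 𝕜 (E × JohnsonSpace G)) :=
  isRightUniversallyFlat_of_factorization fun S hS => hE.exists_triple_factorization hG S hS

end Forward

/-! ### Compact sets and null sequences -/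

section NullSequences

open Filter Topology

/-- Number the disjoint union of the `B k` injectively and put zero at unused indices; only finitely
many levels contain vectors of norm at least `ε`. -/
theorem exists_tendsto_zero_forall_subset_range {E : Type*} [NormedAddCommGroup E]
    (B : ℕ → Set E) (hB : ∀ k, (B k).Finite) (r : ℕ → ℝ) (hr : Tendsto r atTop (𝓝 0))
    (hBr : ∀ k, ∀ b ∈ B k, ‖b‖ ≤ r k) :
    ∃ x : ℕ → E, Tendsto x atTop (𝓝 0) ∧ ∀ k, B k ⊆ Set.range x := by
  have := fun k => (hB k).to_subtype
  obtain ⟨σ, hσ⟩ := exists_injective_nat (Σ k, B k)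
  refine ⟨Function.extend σ (fun p => p.2.1) 0, ?_, fun k b hb =>
    ⟨σ ⟨k, b, hb⟩, hσ.extend_apply _ _ _⟩⟩
  rw [← Nat.cofinite_eq_atTop, Metric.tendsto_nhds]
  intro ε hε
  obtain ⟨N, hN⟩ := eventually_atTop.1 (hr.eventually (gt_mem_nhds hε))
  have hfin : (⋃ k ∈ Set.Iio N, Set.range (Sigma.mk (β := fun k => B k) k)).Finite :=
    (Set.finite_Iio N).biUnion fun k _ => Set.finite_range _
  refine (hfin.image σ).subset fun n hn => ?_
  simp only [dist_zero_right, Set.mem_compl_iff, Set.mem_ofPred_eq, not_lt] at hn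
  by_cases h : ∃ p, σ p = n
  · obtain ⟨⟨k, b, hb⟩, rfl⟩ := h
    rw [hσ.extend_apply] at hn
    refine ⟨⟨k, b, hb⟩, Set.mem_iUnion₂.2 ⟨k, ?_, ⟨b, hb⟩, rfl⟩, rfl⟩
    by_contra hk
    exact absurd ((hBr k b hb).trans_lt (hN k (not_lt.1 hk))) (not_lt.2 hn)
  · rw [Function.extend_apply' _ _ _ h] at hn
    simp only [Pi.zero_apply, norm_zero] at hn
    exact absurd hε (not_lt.2 hn)

/-- A compact set lies in the `σ`-convex hull of a null sequence. -/
theorem IsCompact.exists_tendsto_zero_hasSum (𝕜 : Type*) [RCLike 𝕜] {E : Type*}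
    [NormedAddCommGroup E] [NormedSpace 𝕜 E] [CompleteSpace E] {K : Set E} (hK : IsCompact K) :
    ∃ x : ℕ → E, Tendsto x atTop (𝓝 0) ∧ ∀ z ∈ K, ∃ g : ℕ → ℕ,
      HasSum (fun k => ((1 / 2 : 𝕜) ^ (k + 1)) • x (g k)) z := by
  obtain ⟨M, hM, hKM⟩ := hK.isBounded.subset_ball_lt 0 0
  have hD : ∀ k : ℕ, ∃ D : Set E, D.Finite ∧ (∀ z ∈ K, ∃ d ∈ D, ‖z - d‖ < M * (1 / 8) ^ k) ∧
      (k = 0 → D = {0}) := by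
    intro k
    rcases k with - | k
    · exact ⟨{0}, Set.finite_singleton _, fun z hz => ⟨0, rfl, by simpa using hKM hz⟩, fun _ => rfl⟩
    · obtain ⟨D, -, hDf, hD⟩ := hK.finite_cover_balls (e := M * (1 / 8) ^ (k + 1)) (by positivity)
      refine ⟨D, hDf, fun z hz => ?_, by simp⟩
      obtain ⟨d, hd, hzd⟩ := Set.mem_iUnion₂.1 (hD hz)
      exact ⟨d, hd, by rwa [Metric.mem_ball, dist_eq_norm] at hzd⟩
  choose D hDf hD hD0 using hD
  -- The null sequence lists rescaled differences of consecutive net points. Those that are needed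
  -- have norm at most `2ᵏ⁺¹ · 2M · 8⁻ᵏ = 4M · 4⁻ᵏ`; the ball discards the others.
  obtain ⟨x, hx, hxB⟩ := exists_tendsto_zero_forall_subset_range
    (fun k => ((fun p : E × E => ((2 : 𝕜) ^ (k + 1)) • (p.2 - p.1)) '' (D k ×ˢ D (k + 1))) ∩
      Metric.closedBall 0 (4 * M * (1 / 4) ^ k))
    (fun k => (((hDf k).prod (hDf (k + 1))).image _).inter_of_left _)
    (fun k => 4 * M * (1 / 4) ^ k)
    (by simpa using (tendsto_pow_atTop_nhds_zero_of_lt_one (r := (1 / 4 : ℝ)) (by norm_num)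
      (by norm_num)).const_mul (4 * M))
    (fun k b hb => by simpa using hb.2)
  refine ⟨x, hx, fun z hz => ?_⟩
  choose d hd hzd using fun k => hD k z hz
  have hd0 : d 0 = 0 := by simpa [hD0 0 rfl] using hd 0
  have hdn : ∀ k, ‖d (k + 1) - d k‖ ≤ 2 * M * (1 / 8) ^ k := by
    intro k
    have h1 : d (k + 1) - d k = (z - d k) - (z - d (k + 1)) := by abel
    have h2 := norm_sub_le (z - d k) (z - d (k + 1))
    have h3 := hzd k
    have h4 := hzd (k + 1)
    have h5 : 0 < M * (1 / 8 : ℝ) ^ k := by positivity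
    rw [h1]
    rw [pow_succ] at h4
    linarith
  have hg : ∀ k, ∃ n, x n = ((2 : 𝕜) ^ (k + 1)) • (d (k + 1) - d k) := by
    intro k
    refine hxB k ⟨⟨(d k, d (k + 1)), ⟨hd k, hd (k + 1)⟩, rfl⟩, ?_⟩
    rw [mem_closedBall_zero_iff, norm_smul, norm_pow, RCLike.norm_ofNat]
    refine (mul_le_mul_of_nonneg_left (hdn k) (by positivity)).trans_eq ?_
    have h2 : (1 / 4 : ℝ) ^ k = 2 ^ k * (1 / 8) ^ k := by
      rw [← mul_pow]; norm_num
    rw [h2]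
    ring
  choose g hg using hg
  refine ⟨g, ?_⟩
  have h1 : ∀ k, ((1 / 2 : 𝕜) ^ (k + 1)) • x (g k) = d (k + 1) - d k := fun k => by
    rw [hg, smul_smul, ← mul_pow]
    norm_num
  simp_rw [h1]
  have hs : Summable fun k => d (k + 1) - d k := Summable.of_norm_bounded
    ((summable_geometric_of_lt_one (by norm_num) (by norm_num)).mul_left _) hdn
  refine hs.hasSum_iff_tendsto_nat.2 ?_
  simp_rw [Finset.sum_range_sub, hd0, sub_zero]
  rw [tendsto_iff_norm_sub_tendsto_zero]
  refine squeeze_zero (fun _ => norm_nonneg _) (fun k => ?_)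
    (g := fun k => M * (1 / 8) ^ k)
    (by simpa using (tendsto_pow_atTop_nhds_zero_of_lt_one (r := (1 / 8 : ℝ)) (by norm_num)
      (by norm_num)).const_mul M)
  rw [norm_sub_rev]
  exact (hzd k).le

/-- It suffices to approximate the identity on null sequences. -/
theorem hasApproximationProperty_of_null_sequences {𝕜 : Type*} [RCLike 𝕜] {E : Type*}
    [NormedAddCommGroup E] [NormedSpace 𝕜 E] [CompleteSpace E]
    (H : ∀ x : ℕ → E, Tendsto x atTop (𝓝 0) → ∀ ε : ℝ, 0 < ε →
      ∃ T ∈ finiteRankMaps 𝕜 E E, ∀ n, ‖T (x n) - x n‖ ≤ ε) : HasApproximationProperty 𝕜 E := by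
  intro K hK ε hε
  obtain ⟨x, hx, hxK⟩ := hK.exists_tendsto_zero_hasSum 𝕜
  obtain ⟨T, hT, hTx⟩ := H x hx ε hε
  refine ⟨T, hT, fun z hz => ?_⟩
  obtain ⟨g, hg⟩ := hxK z hz
  have h1 := (hg.mapL T).sub hg
  have h2 : HasSum (fun k : ℕ => ε / 2 / 2 ^ k) ε := hasSum_geometric_two' ε
  refine h1.norm_le_of_bounded h2 fun k => ?_
  rw [map_smul, ← smul_sub, norm_smul, norm_pow, norm_div, norm_one, RCLike.norm_ofNat]
  refine (mul_le_mul_of_nonneg_left (hTx _) (by positivity)).trans_eq ?_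
  rw [one_div, inv_pow, pow_succ]
  field_simp

end NullSequences

/-! ### Duality of `c₀` and approximation of functionals -/

section ZeroAtInfty

open Filter Topology
open scoped ZeroAtInfty

variable {𝕜 : Type*} [RCLike 𝕜]

theorem ZeroAtInftyContinuousMap.norm_le_of_forall_le {f : C₀(ℕ, 𝕜)} {C : ℝ} (hC : 0 ≤ C)
    (h : ∀ n, ‖f n‖ ≤ C) : ‖f‖ ≤ C := by
  rw [← ZeroAtInftyContinuousMap.norm_toBCF_eq_norm]
  exact (BoundedContinuousFunction.norm_le hC).2 h

/-- A null sequence as an element of `c₀`. -/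
def ZeroAtInftyContinuousMap.ofTendsto (h : ℕ → 𝕜) (hh : Tendsto h atTop (𝓝 0)) : C₀(ℕ, 𝕜) where
  toFun := h
  continuous_toFun := continuous_of_discreteTopology
  zero_at_infty' := by rwa [cocompact_eq_cofinite, Nat.cofinite_eq_atTop]

theorem ZeroAtInftyContinuousMap.tendsto_atTop (f : C₀(ℕ, 𝕜)) : Tendsto f atTop (𝓝 0) := by
  have h := f.zero_at_infty'
  rwa [cocompact_eq_cofinite, Nat.cofinite_eq_atTop] at h

/-- The dual of `c₀` is `ℓ¹`. -/
theorem ZeroAtInftyContinuousMap.exists_hasSum_dual (φ : C₀(ℕ, 𝕜) →L[𝕜] 𝕜) :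
    ∃ b : ℕ → 𝕜, Summable (fun n => ‖b n‖) ∧ ∀ h, HasSum (fun n => b n * h n) (φ h) := by
  let δ : ℕ → C₀(ℕ, 𝕜) := fun n => ofTendsto (Pi.single n 1)
    (tendsto_const_nhds.congr' ((eventually_gt_atTop n).mono fun m hm => by
      rw [Pi.single_eq_of_ne hm.ne']))
  have hδ : ∀ (s : Finset ℕ) (c : ℕ → 𝕜) (m : ℕ),
      (∑ n ∈ s, c n • δ n) m = if m ∈ s then c m else 0 := by
    intro s c m
    have h1 : (∑ n ∈ s, c n • δ n) m = ∑ n ∈ s, c n * (Pi.single n 1 : ℕ → 𝕜) m := by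
      induction s using Finset.induction_on with
      | empty => rfl
      | insert a s ha ih => rw [Finset.sum_insert ha, Finset.sum_insert ha, ← ih]; rfl
    rw [h1]
    simp [Pi.single_apply]
  have hsum : ∀ h : C₀(ℕ, 𝕜), HasSum (fun n => h n • δ n) h := by
    intro h
    rw [HasSum, SummationFilter.unconditional_filter, Metric.tendsto_nhds]
    intro ε hε
    obtain ⟨N, hN⟩ := eventually_atTop.1
      (Metric.tendsto_nhds.1 h.tendsto_atTop (ε / 2) (by positivity))
    filter_upwards [eventually_ge_atTop (Finset.range N)] with s hs
    rw [dist_eq_norm]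
    refine (norm_le_of_forall_le (C := ε / 2) (by positivity) fun m => ?_).trans_lt (by linarith)
    rw [ZeroAtInftyContinuousMap.sub_apply, hδ]
    split_ifs with hm
    · rw [sub_self, norm_zero]; positivity
    · rw [zero_sub, norm_neg]
      have h2 : N ≤ m := by
        by_contra hlt
        exact hm (hs (Finset.mem_range.2 (not_le.1 hlt)))
      simpa using (hN m h2).le
  refine ⟨fun n => φ (δ n), ?_, fun h => ?_⟩
  · choose c hc1 hc2 using fun n => RCLike.exists_norm_eq_mul_self (φ (δ n))
    refine summable_of_sum_le (c := ‖φ‖) (fun _ => norm_nonneg _) fun s => ?_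
    have h1 : ((∑ n ∈ s, ‖φ (δ n)‖ : ℝ) : 𝕜) = φ (∑ n ∈ s, c n • δ n) := by
      rw [map_sum]
      push_cast
      exact Finset.sum_congr rfl fun n _ => by rw [map_smul, smul_eq_mul]; exact hc2 n
    have h2 : ‖φ (∑ n ∈ s, c n • δ n)‖ ≤ ‖φ‖ * 1 := by
      refine φ.le_opNorm_of_le (norm_le_of_forall_le zero_le_one fun m => ?_)
      rw [hδ]
      split_ifs
      · exact (hc1 m).le
      · simp
    rw [← h1, RCLike.norm_ofReal, mul_one] at h2
    exact (le_abs_self _).trans h2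
  · have h1 := (hsum h).mapL φ
    simpa [mul_comm] using h1

variable {E : Type*} [NormedAddCommGroup E] [NormedSpace 𝕜 E]

/-- A bounded functional compatible with all relations between the vectors `x n` is approximated
by bounded functionals, uniformly along the null sequence `t n • x n`. -/
theorem exists_dual_norm_mul_sub_le [CompleteSpace E] (x : ℕ → E) (t : ℕ → 𝕜)
    (ht : Tendsto t atTop (𝓝 0)) {C : ℝ} (hx : ∀ n, ‖x n‖ ≤ C) (g : ℕ → 𝕜) {C' : ℝ}
    (hg : ∀ n, ‖g n‖ ≤ C')
    (H : ∀ b : ℕ → 𝕜, Summable (fun n => ‖b n‖) → HasSum (fun n => (b n * t n) • x n) 0 →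
      HasSum (fun n => b n * (t n * g n)) 0) {ε : ℝ} (hε : 0 < ε) :
    ∃ f : E →L[𝕜] 𝕜, ∀ n, ‖t n * (f (x n) - g n)‖ ≤ ε := by
  have hmul : ∀ (y : ℕ → 𝕜) (D : ℝ), (∀ n, ‖y n‖ ≤ D) →
      Tendsto (fun n => t n * y n) atTop (𝓝 0) := fun y D hy => by
    refine squeeze_zero_norm (fun n => ?_) (by simpa using ht.norm.mul_const D)
    rw [norm_mul]
    exact mul_le_mul_of_nonneg_left (hy n) (norm_nonneg _)
  have hf : ∀ (f : E →L[𝕜] 𝕜) n, ‖f (x n)‖ ≤ ‖f‖ * C := fun f n => f.le_opNorm_of_le (hx n)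
  let P : (E →L[𝕜] 𝕜) →ₗ[𝕜] C₀(ℕ, 𝕜) :=
    { toFun := fun f => ZeroAtInftyContinuousMap.ofTendsto _ (hmul (fun n => f (x n)) _ (hf f))
      map_add' := fun f f' => ZeroAtInftyContinuousMap.ext fun n => mul_add _ _ _
      map_smul' := fun c f => ZeroAtInftyContinuousMap.ext fun n => mul_left_comm _ _ _ }
  let h := ZeroAtInftyContinuousMap.ofTendsto _ (hmul g C' hg)
  have hmem : h ∈ (LinearMap.range P).topologicalClosure := by
    -- Otherwise some functional on `c₀` kills the range of `P` but not `h`. Its `ℓ¹` coefficients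
    -- `b` give the relation `∑ bₙ tₙ xₙ = 0`, as every `f` annihilates that sum, and `H` forces the
    -- functional to vanish at `h`.
    by_contra hcon
    set N := (LinearMap.range P).topologicalClosure with hN
    have : IsClosed (N : Set C₀(ℕ, 𝕜)) := Submodule.isClosed_topologicalClosure _
    have hne : ‖N.mkQ h‖ ≠ 0 := fun h0 => hcon ((Submodule.Quotient.mk_eq_zero N).1
      ((norm_eq_zero (E := C₀(ℕ, 𝕜) ⧸ N)).1 h0))
    obtain ⟨ψ, -, hψ⟩ := exists_dual_vector 𝕜 (N.mkQ h) hne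
    let φ : C₀(ℕ, 𝕜) →L[𝕜] 𝕜 := ψ ∘L N.mkQL
    have hφN : ∀ y ∈ N, φ y = 0 := fun y hy => by
      change ψ (N.mkQ y) = 0
      have h1 : N.mkQ y = 0 := (Submodule.Quotient.mk_eq_zero N).2 hy
      rw [h1, map_zero]
    obtain ⟨b, hb, hbφ⟩ := ZeroAtInftyContinuousMap.exists_hasSum_dual φ
    have hsx : Summable fun n => (b n * t n) • x n := by
      obtain ⟨D, hD⟩ := (Metric.isBounded_range_of_tendsto t ht).exists_norm_le
      refine Summable.of_norm_bounded (hb.mul_right (D * C)) fun n => ?_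
      rw [norm_smul, norm_mul, mul_assoc]
      have h1 := hD (t n) ⟨n, rfl⟩
      exact mul_le_mul_of_nonneg_left (mul_le_mul h1 (hx n) (norm_nonneg _)
        ((norm_nonneg _).trans h1)) (norm_nonneg _)
    have h0 : ∑' n, (b n * t n) • x n = 0 := by
      refine SeparatingDual.eq_zero_of_forall_dual_eq_zero (R := 𝕜) fun f => ?_
      have h1 := hsx.hasSum.mapL f
      have h2 := hbφ (P f)
      rw [hφN _ (subset_closure ⟨f, rfl⟩)] at h2
      refine h1.unique ?_
      convert h2 using 2 with n
      rw [map_smul, smul_eq_mul, mul_assoc]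
      rfl
    have h3 := (hbφ h).unique (H b hb (h0 ▸ hsx.hasSum))
    have h4 : ψ (N.mkQ h) = 0 := h3
    exact hne (RCLike.ofReal_eq_zero.1 (hψ.symm.trans h4))
  obtain ⟨_, ⟨f, rfl⟩, hfd⟩ := Metric.mem_closure_iff.1 hmem ε hε
  refine ⟨f, fun n => ?_⟩
  rw [dist_comm, dist_eq_norm] at hfd
  refine le_trans ?_ hfd.le
  have h1 := (P f - h).toBCF.norm_coe_le_norm n
  rw [ZeroAtInftyContinuousMap.norm_toBCF_eq_norm] at h1
  refine le_trans (le_of_eq ?_) h1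
  rw [mul_sub]
  rfl

end ZeroAtInfty

/-! ### From flatness to the approximation property -/

section Converse

open Filter Topology

/-- Relations `T ∘ S = 0` in the algebra of approximable operators, when a copy of it as a right
module is flat. -/
theorem RightAction.IsFlat.exists_finiteRankMaps {𝕜 : Type u} [RCLike 𝕜] {X : Type v}
    [NormedAddCommGroup X] [NormedSpace 𝕜 X] {V : Type v} [AddCommGroup V] [Module 𝕜 V]
    {r : RightAction 𝕜 (approximableOperators 𝕜 X) V} (hr : r.IsFlat)
    (j : V →ₗ[𝕜] approximableOperators 𝕜 X) (hjb : Function.Bijective j)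
    (hj : ∀ a x, j (r.act a x) = j x * a) {T S : X →L[𝕜] X} (hT : T ∈ approximableMaps 𝕜 X X)
    (hS : S ∈ approximableMaps 𝕜 X X) (hTS : T ∘L S = 0) {ε : ℝ} (hε : 0 < ε) :
    ∃ φ ∈ finiteRankMaps 𝕜 X X, φ ∘L S = 0 ∧ ‖φ - T‖ ≤ ε := by
  -- All bounded operators are used, so that the identity is available and `x ⊗ id` records `T`. The
  -- lift only meets the universe in the definition of flatness.
  let M := ULift.{u} (X →L[𝕜] X)
  let ρ : LeftAction 𝕜 (approximableOperators 𝕜 X) M :=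
    { act := LinearMap.mk₂ 𝕜 (fun a m => ULift.up (a.1 ∘L m.down))
        (fun a b m => ULift.ext _ _ (ContinuousLinearMap.add_comp _ _ _))
        (fun c a m => ULift.ext _ _ (ContinuousLinearMap.smul_comp _ _ _))
        (fun a m m' => ULift.ext _ _ (ContinuousLinearMap.comp_add _ _ _))
        (fun c a m => ULift.ext _ _ (ContinuousLinearMap.comp_smul _ _ _))
      act_mul := fun a b m => rfl }
  let R : M →ₗ[𝕜] M :=
    { toFun := fun m => ULift.up (m.down ∘L S)
      map_add' := fun m m' => ULift.ext _ _ (ContinuousLinearMap.add_comp _ _ _)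
      map_smul' := fun c m => ULift.ext _ _ (ContinuousLinearMap.smul_comp _ _ _) }
  let s : approximableOperators 𝕜 X := ⟨S, mem_approximableOperators_iff.2 hS⟩
  obtain ⟨x, hx⟩ := hjb.2 ⟨T, mem_approximableOperators_iff.2 hT⟩
  have hxs : r.act s x = 0 := hjb.1 (by
    rw [hj, hx, map_zero]
    exact Subtype.ext hTS)
  have hR : R (ULift.up (ContinuousLinearMap.id 𝕜 X)) =
      ρ.act s (ULift.up (ContinuousLinearMap.id 𝕜 X)) := rfl
  -- Balancing gives `x ⊗ R id = x ⊗ s · id = x · s ⊗ id = 0`.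
  obtain ⟨t, ht⟩ := hr.exists_of_endomorphism ρ R (fun _ _ => rfl) x
    (ULift.up (ContinuousLinearMap.id 𝕜 X)) (by
      have h := smul_tmul_sub_mem_balancedSubmodule r ρ x s
        (ULift.up (ContinuousLinearMap.id 𝕜 X))
      rw [hxs, TensorProduct.zero_tmul, zero_sub, neg_mem_iff] at h
      rwa [hR])
  let μ : V ⊗[𝕜] M →ₗ[𝕜] (X →L[𝕜] X) := TensorProduct.lift (LinearMap.mk₂ 𝕜
    (fun x m => (j x).1 ∘L m.down)
    (fun a b m => by rw [map_add]; exact ContinuousLinearMap.add_comp _ _ _)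
    (fun c a m => by rw [map_smul]; exact ContinuousLinearMap.smul_comp _ _ _)
    (fun a m m' => ContinuousLinearMap.comp_add _ _ _)
    (fun c a m => ContinuousLinearMap.comp_smul _ _ _))
  have hμ : balancedSubmodule r ρ ≤ LinearMap.ker μ := by
    refine Submodule.span_le.2 ?_
    rintro _ ⟨x, a, m, rfl⟩
    change μ _ = 0
    rw [map_sub, sub_eq_zero]
    change (j (r.act a x)).1 ∘L m.down = (j x).1 ∘L (a.1 ∘L m.down)
    rw [hj]
    rfl
  have hμt : T = μ ((LinearMap.ker R).subtype.lTensor V t) := by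
    have h := hμ ht
    rw [LinearMap.mem_ker, map_sub, sub_eq_zero] at h
    rw [← h]
    change T = (j x).1 ∘L ContinuousLinearMap.id 𝕜 X
    rw [hx, ContinuousLinearMap.comp_id]
  -- `T` is now a sum of terms `(j x) ∘ c` with `c ∘ S = 0`; approximating `j x` by finite rank
  -- operators preserves annihilation of `S`.
  let Φ : Submodule 𝕜 (X →L[𝕜] X) := finiteRankMaps 𝕜 X X ⊓
    LinearMap.ker (ContinuousLinearMap.precomp X S).toLinearMap
  have hmem : ∀ t, μ ((LinearMap.ker R).subtype.lTensor V t) ∈ Φ.topologicalClosure := by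
    intro t
    induction t with
    | zero => rw [map_zero, map_zero]; exact zero_mem _
    | add a b ha hb => rw [map_add, map_add]; exact add_mem ha hb
    | tmul x c =>
      obtain ⟨⟨c⟩, hc⟩ := c
      have hc' : c ∘L S = 0 := congrArg ULift.down hc
      refine map_mem_closure (f := fun y : X →L[𝕜] X => y ∘L c) (by fun_prop)
        (mem_approximableOperators_iff.1 (j x).2) fun y hy =>
        ⟨mem_finiteRankMaps_comp_right hy c, ?_⟩
      change (y ∘L c) ∘L S = 0
      rw [ContinuousLinearMap.comp_assoc, hc', ContinuousLinearMap.comp_zero]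
  have hTm := hmem t
  rw [← hμt] at hTm
  obtain ⟨φ, hφ, h⟩ := Metric.mem_closure_iff.1 hTm ε hε
  exact ⟨φ, hφ.1, hφ.2, by rw [← dist_eq_norm, dist_comm]; exact h.le⟩

theorem isSeparable_univ_lp_one (𝕜 : Type*) [RCLike 𝕜] (G : ℕ → Type v)
    [∀ i, NormedAddCommGroup (G i)] [∀ i, NormedSpace 𝕜 (G i)] [∀ i, FiniteDimensional 𝕜 (G i)] :
    TopologicalSpace.IsSeparable (Set.univ : Set (JohnsonSpace G)) := by
  have := fun i => FiniteDimensional.proper 𝕜 (G i)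
  have h1 : TopologicalSpace.IsSeparable
      (⋃ i, Set.range (lp.singleContinuousLinearMap 𝕜 G 1 i)) :=
    TopologicalSpace.IsSeparable.iUnion fun i =>
      TopologicalSpace.isSeparable_range (lp.singleContinuousLinearMap 𝕜 G 1 i).continuous
  refine (h1.span (R := 𝕜)).closure.mono fun c _ => ?_
  refine mem_closure_of_tendsto (lp.hasSum_single ENNReal.one_ne_top c)
    (Eventually.of_forall fun s => Submodule.sum_mem _ fun i _ => Submodule.subset_span ?_)
  exact Set.mem_iUnion.2 ⟨i, c i, rfl⟩

variable {𝕜 : Type u} [RCLike 𝕜] {G : ℕ → Type v} [∀ i, NormedAddCommGroup (G i)]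
    [∀ i, NormedSpace 𝕜 (G i)]

/-- The `ℓ¹`-sum contains a copy of the basis of `ℓ¹`, with biorthogonal functionals. -/
theorem IsJohnsonSequence.exists_biorthogonal (hG : IsJohnsonSequence 𝕜 G) :
    ∃ (e : ℕ → JohnsonSpace G) (ψ : ℕ → JohnsonSpace G →L[𝕜] 𝕜), (∀ n, ‖e n‖ ≤ 2) ∧
      (∀ n, ψ n (e n) = 1) ∧ (∀ m n, m ≠ n → ψ m (e n) = 0) ∧
      ∀ (s : Finset ℕ) c, ∑ n ∈ s, ‖ψ n c‖ ≤ ‖c‖ := by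
  obtain ⟨τ, hτ, p, q, hpq⟩ := hG.exists_retracts fun _ => 𝕜
  refine ⟨fun n => lp.single 1 (τ n) (p n 1), fun n => q n ∘L lp.evalCLM 𝕜 G 1 (τ n),
    fun n => ?_, fun n => ?_, fun m n hmn => ?_, fun s c => ?_⟩
  · rw [lp.norm_single one_pos]
    simpa using (p n).le_of_opNorm_le (hpq n).2.1 1
  · change q n (lp.single 1 (τ n) (p n 1) (τ n)) = 1
    rw [lp.single_apply_self, (hpq n).1]
  · change q m (lp.single 1 (τ n) (p n 1) (τ m)) = 0
    rw [lp.single_apply_ne _ _ _ (hτ.injective.ne hmn), map_zero]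
  · have h2 := lp.sum_rpow_le_norm_rpow (E := G) (p := 1) (by simp) c (s.map ⟨τ, hτ.injective⟩)
    simp only [ENNReal.toReal_one, Real.rpow_one, Finset.sum_map] at h2
    refine (Finset.sum_le_sum fun n _ => ?_).trans h2
    exact ((q n).le_of_opNorm_le (hpq n).2.2 (c (τ n))).trans_eq (one_mul _)

/-- The approximable operator sending a basis of `ℓ¹` to a null sequence. -/
theorem exists_approximableMaps_hasSum {C Y : Type*} [NormedAddCommGroup C] [NormedSpace 𝕜 C]
    [NormedAddCommGroup Y] [NormedSpace 𝕜 Y] [CompleteSpace Y] {ψ : ℕ → C →L[𝕜] 𝕜}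
    (hψ : ∀ (s : Finset ℕ) c, ∑ n ∈ s, ‖ψ n c‖ ≤ ‖c‖) {y : ℕ → Y} (hy : Tendsto y atTop (𝓝 0)) :
    ∃ V ∈ approximableMaps 𝕜 C Y, ∀ c, HasSum (fun n => ψ n c • y n) (V c) := by
  -- The norms of the terms need not be summable. Tails are small because `∑ ‖ψ n c‖ ≤ ‖c‖` is
  -- weighted by a tail supremum of `‖y n‖`.
  have hs : Summable fun n => (ψ n).smulRight (y n) := by
    rw [summable_iff_vanishing_norm]
    intro ε hε
    obtain ⟨N, hN⟩ := eventually_atTop.1 (Metric.tendsto_nhds.1 hy (ε / 2) (by positivity))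
    refine ⟨Finset.range N, fun t ht => ?_⟩
    refine (ContinuousLinearMap.opNorm_le_bound _ (by positivity : 0 ≤ ε / 2)
      fun c => ?_).trans_lt (half_lt_self hε)
    rw [_root_.sum_apply]
    refine (norm_sum_le_of_le t (f := fun n => (ψ n).smulRight (y n) c)
      (n := fun n => ε / 2 * ‖ψ n c‖) fun n hn => ?_).trans ?_
    · rw [ContinuousLinearMap.smulRight_apply, norm_smul, mul_comm]
      have h1 : N ≤ n := by
        by_contra hlt
        exact Finset.disjoint_left.1 ht hn (Finset.mem_range.2 (not_le.1 hlt))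
      refine mul_le_mul_of_nonneg_right ?_ (norm_nonneg _)
      simpa using (hN n h1).le
    · rw [← Finset.mul_sum]
      exact mul_le_mul_of_nonneg_left (hψ t c) (by positivity)
  refine ⟨∑' n, (ψ n).smulRight (y n), mem_approximableMaps_of_hasSum hs.hasSum fun n =>
    finiteRankMaps_le_approximableMaps ?_, fun c =>
      hs.hasSum.mapL (ContinuousLinearMap.apply 𝕜 Y c)⟩
  exact mem_finiteRankMaps_comp_left ((ContinuousLinearMap.id 𝕜 𝕜).smulRight (y n))
    (mem_finiteRankMaps_of_finiteDimensional_right (ψ n))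

/-- A finite rank operator vanishing on the relations between the vectors `x n` is approximated
by finite rank operators, uniformly along the null sequence `t n • x n`. -/
theorem exists_finiteRankMaps_norm_smul_sub_le {C E : Type*} [NormedAddCommGroup C]
    [NormedSpace 𝕜 C] [CompleteSpace C] [NormedAddCommGroup E] [NormedSpace 𝕜 E] [CompleteSpace E]
    {w φ : C →L[𝕜] E} (hφ : φ ∈ finiteRankMaps 𝕜 C E) (hwφ : ∀ c, w c = 0 → φ c = 0)
    (e : ℕ → C) {D : ℝ} (he : ∀ n, ‖e n‖ ≤ D) (t : ℕ → 𝕜) (ht : Tendsto t atTop (𝓝 0))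
    {ε : ℝ} (hε : 0 < ε) :
    ∃ T ∈ finiteRankMaps 𝕜 E E, ∀ n, ‖t n • (T (w (e n)) - φ (e n))‖ ≤ ε := by
  have : FiniteDimensional 𝕜 (LinearMap.range (φ : C →ₗ[𝕜] E)) := hφ
  let b := Module.finBasis 𝕜 (LinearMap.range (φ : C →ₗ[𝕜] E))
  let φ' : C →L[𝕜] LinearMap.range (φ : C →ₗ[𝕜] E) := φ.codRestrict _ fun c => ⟨c, rfl⟩
  let g : _ → C →L[𝕜] 𝕜 := fun i => (b.coord i).toContinuousLinearMap ∘L φ'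
  have hφg : ∀ c, φ c = ∑ i, g i c • (b i : E) := by
    intro c
    have h := congrArg Subtype.val (b.sum_repr (φ' c))
    rw [← show ((φ' c : LinearMap.range (φ : C →ₗ[𝕜] E)) : E) = φ c from rfl, ← h,
      Submodule.coe_sum]
    rfl
  have hgw : ∀ i c, w c = 0 → g i c = 0 := by
    intro i c hc
    have h : φ' c = 0 := Subtype.ext (hwφ c hc)
    change b.coord i (φ' c) = 0
    rw [h, map_zero]
  have hf : ∀ i, ∃ f : E →L[𝕜] 𝕜, ∀ n, ‖t n * (f (w (e n)) - g i (e n))‖ ≤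
      ε / ((Module.finrank 𝕜 (LinearMap.range (φ : C →ₗ[𝕜] E)) + 1) * (‖(b i : E)‖ + 1)) := by
    intro i
    refine exists_dual_norm_mul_sub_le (fun n => w (e n)) t ht (C := ‖w‖ * D)
      (fun n => w.le_opNorm_of_le (he n)) (fun n => g i (e n)) (C' := ‖g i‖ * D)
      (fun n => (g i).le_opNorm_of_le (he n)) (fun β hβ hβw => ?_) (by positivity)
    -- A relation among the `w (e n)` lifts to the vector `∑ βₙ tₙ eₙ` of `ker w`, on which `g i`
    -- vanishes.
    have hs : Summable fun n => (β n * t n) • e n := by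
      obtain ⟨D', hD'⟩ := (Metric.isBounded_range_of_tendsto t ht).exists_norm_le
      refine Summable.of_norm_bounded (hβ.mul_right (D' * D)) fun n => ?_
      rw [norm_smul, norm_mul, mul_assoc]
      have h1 := hD' (t n) ⟨n, rfl⟩
      exact mul_le_mul_of_nonneg_left (mul_le_mul h1 (he n) (norm_nonneg _)
        ((norm_nonneg _).trans h1)) (norm_nonneg _)
    have h1 : w (∑' n, (β n * t n) • e n) = 0 := by
      refine (hs.hasSum.mapL w).unique ?_
      simpa only [map_smul] using hβw
    have h2 := hs.hasSum.mapL (g i)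
    rw [hgw i _ h1] at h2
    simpa only [map_smul, smul_eq_mul, mul_assoc] using h2
  choose f hf using hf
  refine ⟨∑ i, (f i).smulRight (b i : E), Submodule.sum_mem _ fun i _ =>
    mem_finiteRankMaps_comp_left ((ContinuousLinearMap.id 𝕜 𝕜).smulRight (b i : E))
      (mem_finiteRankMaps_of_finiteDimensional_right (f i)), fun n => ?_⟩
  have h1 : t n • ((∑ i, (f i).smulRight (b i : E)) (w (e n)) - φ (e n)) =
      ∑ i, (t n * (f i (w (e n)) - g i (e n))) • (b i : E) := by
    rw [hφg, _root_.sum_apply, ← Finset.sum_sub_distrib, Finset.smul_sum]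
    refine Finset.sum_congr rfl fun i _ => ?_
    rw [ContinuousLinearMap.smulRight_apply, ← sub_smul, smul_smul]
  rw [h1]
  refine (norm_sum_le_of_le _ (n := fun _ =>
    ε / (Module.finrank 𝕜 (LinearMap.range (φ : C →ₗ[𝕜] E)) + 1)) fun i _ => ?_).trans ?_
  · rw [norm_smul]
    refine (mul_le_mul_of_nonneg_right (hf i n) (norm_nonneg _)).trans ?_
    rw [← div_div, div_mul_eq_mul_div]
    refine div_le_of_le_mul₀ (by positivity) (by positivity) ?_
    exact mul_le_mul_of_nonneg_left (by linarith) (by positivity)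
  · rw [Finset.sum_const, Finset.card_univ, Fintype.card_fin, nsmul_eq_mul, mul_div_assoc',
      div_le_iff₀ (by positivity), mul_comm]
    exact mul_le_mul_of_nonneg_left (by linarith) hε.le

/-- The copy `V` of the algebra allows one argument for both notions: the algebra itself, and its
image as a right ideal. -/
theorem hasApproximationProperty_of_isFlat (hG : IsJohnsonSequence 𝕜 G) {E : Type w}
    [NormedAddCommGroup E] [NormedSpace 𝕜 E] [CompleteSpace E] {V : Type max w v}
    [AddCommGroup V] [Module 𝕜 V]
    {r : RightAction 𝕜 (approximableOperators 𝕜 (E × JohnsonSpace G)) V} (hr : r.IsFlat)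
    (j : V →ₗ[𝕜] approximableOperators 𝕜 (E × JohnsonSpace G)) (hjb : Function.Bijective j)
    (hj : ∀ a x, j (r.act a x) = j x * a) : HasApproximationProperty 𝕜 E := by
  have := hG.finiteDimensional
  have : ∀ i, CompleteSpace (G i) := fun i => FiniteDimensional.complete 𝕜 (G i)
  refine hasApproximationProperty_of_null_sequences fun x hx ε hε => ?_
  obtain ⟨e, ψ, he, hψ1, hψ0, hψs⟩ := hG.exists_biorthogonal
  -- split `x n = t n • y n` into two null sequences
  let t : ℕ → 𝕜 := fun n => ((√‖x n‖ : ℝ) : 𝕜)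
  let y : ℕ → E := fun n => (t n)⁻¹ • x n
  have ht0 : ∀ n, t n = 0 → x n = 0 := fun n h => by
    simpa [t] using h
  have hsq : Tendsto (fun n => √‖x n‖) atTop (𝓝 0) := by
    simpa [Function.comp_def] using
      (Real.continuous_sqrt.tendsto 0).comp (tendsto_zero_iff_norm_tendsto_zero.1 hx)
  have htn : ∀ n, ‖t n‖ = √‖x n‖ := fun n => by
    simp [t, abs_of_nonneg (Real.sqrt_nonneg _)]
  have ht : Tendsto t atTop (𝓝 0) := by
    rw [tendsto_zero_iff_norm_tendsto_zero]
    simpa only [htn] using hsq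
  have htx : ∀ n, t n • y n = x n := by
    intro n
    by_cases h : t n = 0
    · rw [h, zero_smul, ht0 n h]
    · exact smul_inv_smul₀ h _
  have hy : Tendsto y atTop (𝓝 0) := by
    refine squeeze_zero_norm (fun n => ?_) hsq
    rw [norm_smul, norm_inv, htn, inv_mul_eq_div, Real.div_sqrt]
  obtain ⟨w, hw, hwc⟩ := exists_approximableMaps_hasSum (𝕜 := 𝕜) hψs hy
  have hwe : ∀ n, w (e n) = y n := fun n => (hwc (e n)).unique (by
    have h := hasSum_single (f := fun m => ψ m (e n) • y m) n
      fun m hm => by rw [hψ0 m n hm, zero_smul]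
    simpa only [hψ1, one_smul] using h)
  -- an approximable operator with dense range in the kernel of `w`
  let N := LinearMap.ker (w : JohnsonSpace G →ₗ[𝕜] E)
  have : TopologicalSpace.SeparableSpace N :=
    ((isSeparable_univ_lp_one 𝕜 G).mono (Set.subset_univ (N : Set (JohnsonSpace G)))).separableSpace
  let ν := TopologicalSpace.denseSeq N
  -- Nonzero weights turn the dense sequence into a null sequence with the same span.
  let c : ℕ → 𝕜 := fun n => ((1 / (n + 1) / (1 + ‖ν n‖) : ℝ) : 𝕜)
  have hc0 : ∀ n, c n ≠ 0 := fun n => RCLike.ofReal_ne_zero.2 (by positivity)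
  have hcν : Tendsto (fun n => c n • (ν n : JohnsonSpace G)) atTop (𝓝 0) := by
    refine squeeze_zero_norm (fun n => ?_) tendsto_one_div_add_atTop_nhds_zero_nat
    rw [norm_smul, RCLike.norm_ofReal, abs_of_nonneg (by positivity), div_mul_eq_mul_div]
    refine div_le_of_le_mul₀ (by positivity) (by positivity) ?_
    refine mul_le_mul_of_nonneg_left ?_ (by positivity)
    exact le_add_of_nonneg_left zero_le_one
  obtain ⟨a, ha, hac⟩ := exists_approximableMaps_hasSum (𝕜 := 𝕜) hψs hcν
  have hae : ∀ n, a (e n) = c n • (ν n : JohnsonSpace G) := fun n => (hac (e n)).unique (by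
    have h := hasSum_single (f := fun m => ψ m (e n) • c m • (ν m : JohnsonSpace G)) n
      fun m hm => by rw [hψ0 m n hm, zero_smul]
    simpa only [hψ1, one_smul] using h)
  have hwa : ∀ z, w (a z) = 0 := fun z => ((hac z).mapL w).unique (by
    convert hasSum_zero with n
    have h : w (ν n) = 0 := (ν n).2
    rw [map_smul, map_smul, h, smul_zero, smul_zero])
  obtain ⟨B, hB⟩ := (Metric.isBounded_range_of_tendsto t ht).exists_norm_le
  have hB0 : 0 ≤ B := (norm_nonneg _).trans (hB (t 0) ⟨0, rfl⟩)
  let κ := ContinuousLinearMap.inr 𝕜 E (JohnsonSpace G)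
  let π := ContinuousLinearMap.snd 𝕜 E (JohnsonSpace G)
  let κ' := ContinuousLinearMap.inl 𝕜 E (JohnsonSpace G)
  let π' := ContinuousLinearMap.fst 𝕜 E (JohnsonSpace G)
  -- The tolerance is chosen from `‖t n‖ ≤ B + 1` and `‖e n‖ ≤ 2`, which leave an error of `ε / 2`.
  obtain ⟨Φ, hΦf, hΦa, hΦw⟩ := hr.exists_finiteRankMaps j hjb hj (T := κ' ∘L w ∘L π)
    (S := κ ∘L a ∘L π)
    (mem_approximableMaps_comp_left κ' (mem_approximableMaps_comp_right hw π))
    (mem_approximableMaps_comp_left κ (mem_approximableMaps_comp_right ha π))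
    (ContinuousLinearMap.ext fun z => by
      change κ' (w (a (π z))) = 0
      rw [hwa, map_zero]) (ε := ε / (4 * (B + 1))) (by positivity)
  let φ := π' ∘L Φ ∘L κ
  have hφ : φ ∈ finiteRankMaps 𝕜 (JohnsonSpace G) E :=
    mem_finiteRankMaps_comp_left π' (mem_finiteRankMaps_comp_right hΦf κ)
  have hφa : ∀ z, φ (a z) = 0 := fun z => by
    have h : Φ (κ (a z)) = 0 := DFunLike.congr_fun hΦa (κ z)
    change π' (Φ (κ (a z))) = 0
    rw [h, map_zero]
  have hφw : ∀ z, ‖φ z - w z‖ ≤ ε / (4 * (B + 1)) * ‖z‖ := fun z => by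
    have h1 := (Φ - κ' ∘L w ∘L π).le_of_opNorm_le hΦw (κ z)
    have h2 : ‖κ z‖ = ‖z‖ := by simp [κ, Prod.norm_def]
    rw [h2] at h1
    exact (norm_fst_le ((Φ - κ' ∘L w ∘L π) (κ z))).trans h1
  have hφν : ∀ n, φ (ν n) = 0 := fun n => by
    have h := hφa (e n)
    rw [hae, map_smul] at h
    exact (smul_eq_zero.1 h).resolve_left (hc0 n)
  have hφN : ∀ z, w z = 0 → φ z = 0 := by
    have h1 : (fun z : N => φ z) = fun _ => 0 :=
      (TopologicalSpace.denseRange_denseSeq N).equalizer (by fun_prop) (by fun_prop)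
        (funext hφν)
    exact fun z hz => congrFun h1 ⟨z, hz⟩
  obtain ⟨T, hT, hTφ⟩ := exists_finiteRankMaps_norm_smul_sub_le hφ hφN e he t ht (half_pos hε)
  refine ⟨T, hT, fun n => ?_⟩
  have h1 : T (x n) - x n = t n • (T (w (e n)) - φ (e n)) + t n • (φ (e n) - w (e n)) := by
    rw [← smul_add, sub_add_sub_cancel, hwe, smul_sub, htx, ← map_smul, htx]
  rw [h1]
  refine (norm_add_le_of_le (hTφ n) (?_ : _ ≤ ε / 2)).trans_eq (add_halves ε)
  rw [norm_smul]
  have h2 : ‖φ (e n) - w (e n)‖ ≤ ε / (4 * (B + 1)) * 2 :=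
    (hφw _).trans (mul_le_mul_of_nonneg_left (he n) (by positivity))
  have h3 : ‖t n‖ ≤ B + 1 := (hB _ ⟨n, rfl⟩).trans (by linarith)
  refine (mul_le_mul h3 h2 (norm_nonneg _) (by positivity)).trans_eq ?_
  field_simp
  norm_num

end Converse

theorem theorem1 {𝕜 : Type*} [RCLike 𝕜] {E : Type*} [NormedAddCommGroup E] [NormedSpace 𝕜 E]
    [CompleteSpace E] (G : ℕ → Type*) [∀ i, NormedAddCommGroup (G i)]
    [∀ i, NormedSpace 𝕜 (G i)] (hG : IsJohnsonSequence 𝕜 G) :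
    List.TFAE
      [HasApproximationProperty 𝕜 E,
        IsRightFlat 𝕜 (approximableOperators 𝕜 (E × JohnsonSpace G)),
        IsRightUniversallyFlat 𝕜 (approximableOperators 𝕜 (E × JohnsonSpace G))] := by
  tfae_have 1 → 2 := fun h => h.isRightFlat hG
  tfae_have 1 → 3 := fun h => h.isRightUniversallyFlat hG
  tfae_have 2 → 1 := fun h => hasApproximationProperty_of_isFlat hG h LinearMap.id
    Function.bijective_id fun _ _ => rfl
  -- Universal flatness is used only for the algebra embedded in itself.
  tfae_have 3 → 1 := fun h => by
    have hi : Function.Injective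
        (NonUnitalAlgHom.id 𝕜 (approximableOperators 𝕜 (E × JohnsonSpace G))) :=
      Function.injective_id
    refine hasApproximationProperty_of_isFlat hG (h _ _ hi fun x _ b => ⟨x * b, rfl⟩)
      (Submodule.subtype _) ⟨Subtype.val_injective, fun a => ⟨⟨a, a, rfl⟩, rfl⟩⟩ fun _ _ => rfl
  tfae_finish
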